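/- Let $W=(W_t)_{t\ge 0}$ be a standard real Brownian motion on a probability space $(\Omega,\mathcal F,P)$. Let $L^2_s(\mathbb R_+^2)$ be the set of square-integrable functions $f$ on $\mathbb R_+^2$ (with Lebesgue measure) such that $f(x,y)=f(y,x)$ almost everywhere, and for $f\in L^2_s(\mathbb R_+^2)$ let $I_2^W(f)$ denote the double Wiener--Itô integral of $f$ with respect to $W$, i.e. the $L^2(P)$-limit of $\sum_{i,j}a_{ij}(W_{t_{i+1}}-W_{t_i})(W_{t_{j+1}}-W_{t_j})$ along symmetric step functions $\sum_{i,j}a_{ij}\mathbf 1_{(t_i,t_{i+1}]\times(t_j,t_{j+1}]}$ (with $a_{ij}=a_{ji}$ and $a_{ii}=0$) converging to $f$ in $L^2(\mathbb R_+^2)$. If a sequence $F_n=I_2^W(f_n)$, $n\ge 1$, with $f_n\in L^2_s(\mathbb R_+^2)$, converges in law to a real random variable $F_\infty$ (possibly defined on another probability space), then there exist $\lambda_0\in\mathbb R$ and $f\in L^2_s(\mathbb R_+^2)$ such that $$F_\infty\overset{\rm law}{=}N+I_2^W(f),$$ where $N\sim\mathcal N(0,\lambda_0^2)$ is independent of $W$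 and is defined on a possibly enlarged probability space carrying $W$ ($N=0$ almost surely if $\lambda_0=0$). Conversely, if a real random variable $F_\infty$ has the law of such a sum $N+I_2^W(f)$, then it is the limit in law of a sequence of double Wiener--Itô integrals with respect to $W$. Thus the set of limit laws of sequences of double Wiener--Itô integrals with respect to $W$ is exactly the set of laws of the random variables $N+I_2^W(f)$ of this form. -/

import Mathlib

open MeasureTheory ProbabilityTheory Filter
open scoped NNReal ENNReal Topology

universe u v

/-- Lebesgue measure on `ℝ₊`. -/
noncomputable def lebesgueNNReal : Measure ℝ≥0 :=
  (volume : Measure ℝ).comap ((↑) : ℝ≥0 → ℝ)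

theorem measurableEmbedding_coe_nnreal : MeasurableEmbedding ((↑) : ℝ≥0 → ℝ) :=
  MeasurableEmbedding.subtype_coe measurableSet_Ici

instance instSigmaFiniteLebesgueNNReal : SigmaFinite lebesgueNNReal where
  out' := ⟨{
    set := fun n => Set.Iic (n : ℝ≥0)
    set_mem := fun _ => trivial
    finite := fun n => by
      rw [lebesgueNNReal, measurableEmbedding_coe_nnreal.comap_apply]
      refine lt_of_le_of_lt (measure_mono (t := Set.Icc (0 : ℝ) n) ?_) measure_Icc_lt_top
      rintro _ ⟨y, hy, rfl⟩
      exact ⟨y.2, by exact_mod_cast (Set.mem_Iic.1 hy)⟩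
    spanning := Set.eq_univ_of_forall fun x => by
      obtain ⟨n, hn⟩ := exists_nat_ge x
      exact Set.mem_iUnion.2 ⟨n, hn⟩ }⟩

theorem lebesgueNNReal_Ioc (a b : ℝ≥0) :
    lebesgueNNReal (Set.Ioc a b) = ENNReal.ofReal ((b : ℝ) - a) := by
  have h : ((↑) : ℝ≥0 → ℝ) '' Set.Ioc a b = Set.Ioc (a : ℝ) b := by
    ext x
    constructor
    · rintro ⟨y, hy, rfl⟩
      exact ⟨by exact_mod_cast hy.1, by exact_mod_cast hy.2⟩
    · intro hx
      exact ⟨⟨x, a.2.trans hx.1.le⟩, ⟨hx.1, hx.2⟩, rfl⟩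
  rw [lebesgueNNReal, measurableEmbedding_coe_nnreal.comap_apply, h, Real.volume_Ioc]

/-- A symmetric step function on `ℝ₊²` vanishing on the diagonal: a partition
`t 0 ≤ t 1 ≤ … ≤ t m` of an interval of `ℝ₊`, with cells `(t i, t (i+1)]`, and a symmetric matrix
of values with zero diagonal, `coeff i j` being the value on the product of cells `i` and `j`. -/
structure OffDiagStep where
  m : ℕ
  t : Fin (m + 1) → ℝ≥0
  mono : Monotone t
  coeff : Matrix (Fin m) (Fin m) ℝ
  symm : coeff.IsSymm
  diag : ∀ i, coeff i i = 0

namespace OffDiagStep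

/-- The `i`-th cell `(t i, t (i+1)]` of the partition. -/
def cell (s : OffDiagStep) (i : Fin s.m) : Set ℝ≥0 :=
  Set.Ioc (s.t i.castSucc) (s.t i.succ)

/-- The step function `∑ i j, coeff i j * 1_{cell i}(x) * 1_{cell j}(y)`. -/
noncomputable def toFun (s : OffDiagStep) (p : ℝ≥0 × ℝ≥0) : ℝ :=
  ∑ i, ∑ j, s.coeff i j * ((s.cell i).indicator 1 p.1 * (s.cell j).indicator 1 p.2)

/-- The elementary double integral
`∑ i j, coeff i j * (W (t (i+1)) - W (t i)) * (W (t (j+1)) - W (t j))`. -/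
noncomputable def integral {Ω : Type*} (W : ℝ≥0 → Ω → ℝ) (s : OffDiagStep) (ω : Ω) : ℝ :=
  ∑ i, ∑ j, s.coeff i j *
    ((W (s.t i.succ) ω - W (s.t i.castSucc) ω) * (W (s.t j.succ) ω - W (s.t j.castSucc) ω))

end OffDiagStep

/-- `f` represents an element of `L²_s(ℝ₊²)`: square-integrable for Lebesgue measure, and
symmetric almost everywhere. -/
structure IsSymmL2 (f : ℝ≥0 × ℝ≥0 → ℝ) : Prop where
  memLp : MemLp f 2 (lebesgueNNReal.prod lebesgueNNReal)
  symm : ∀ᵐ p ∂(lebesgueNNReal.prod lebesgueNNReal), f p.swap = f p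

/-- `G = I_2^W(f)` (almost surely): the square-integrable random variable `G` is the double
Wiener–Itô integral of `f ∈ L²_s(ℝ₊²)` with respect to `W`, that is, the `L²(P)`-limit of the
elementary double integrals of off-diagonal symmetric step functions converging to `f` in
`L²(ℝ₊²)`. -/
structure IsDoubleWienerIntegral {Ω : Type*} [MeasurableSpace Ω] (W : ℝ≥0 → Ω → ℝ)
    (P : Measure Ω) (f : ℝ≥0 × ℝ≥0 → ℝ) (G : Ω → ℝ) : Prop where
  isSymmL2 : IsSymmL2 f
  memLp : MemLp G 2 P
  exists_approx : ∃ s : ℕ → OffDiagStep,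
    Tendsto (fun k => eLpNorm (fun p => (s k).toFun p - f p) 2
      (lebesgueNNReal.prod lebesgueNNReal)) atTop (𝓝 0) ∧
    Tendsto (fun k => eLpNorm (fun ω => (s k).integral W ω - G ω) 2 P) atTop (𝓝 0)

/-!
The double Wiener–Itô integrals with respect to a Brownian motion have, up to limits, the laws of
finite sums `∑ c k * (ξ k ² - 1) / √2` with `ξ k` independent standard Gaussian variables. Indeed an
elementary off-diagonal integral is a quadratic form in independent Gaussian increments, with trace
zero once the increments are normalized, and diagonalizing it in finite dimension gives such a sum
(`OffDiagStep.exists_charFun_integral_eq_prod`). Since every double integral is an `L²`-limit of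
elementary ones, no spectral theory of Hilbert–Schmidt operators is needed.

In the other direction, for every square-summable `c` the sum `∑ c k * (ξ k ² - 1) / √2` with
`ξ k = W (k + 1) - W k` is a double integral, whose kernel is a combination of indicators of the
squares `(k, k+1]²`; this is proved by cutting each unit interval into `m` cells and removing the
diagonal cells (`exists_isDoubleWienerIntegral_of_summable_sq`).

Let `ψ` be the characteristic function of `(ξ² - 1) / √2`. The limit theorem becomes a statement on
products of values of `ψ`. If `∏ k, ψ (t * a n k)` converges for all `t` to a characteristic
function, the identity `‖ψ x‖⁴ (1 + 2x²) = 1` bounds the variances `∑ k, a n k ²`. After sorting the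
coefficients by decreasing modulus and passing to a subsequence, `a n k → b k` for each `k` and the
variances converge, to `T` say. The coefficients of large index are uniformly small, so that
`ψ x = exp (-x² / 2) + o(x²)` replaces their factors by Gaussian ones; the limit is
`∏ k, ψ (t * b k)` times the characteristic function of a centred Gaussian variable with variance
`T - ∑ k, b k ²` (`exists_sq_summable_of_tendsto_prod_hermiteTwoCharFun`). Conversely, a Gaussian
factor of variance `σ²` is obtained from `n` additional coefficients `σ / √n`, by the central limit
theorem.
-/

/-! ### The law of `(ξ² - 1) / √2` for a standard Gaussian variable `ξ` -/

/-- The second Hermite polynomial, normalized to have variance one under the standard Gaussian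
law. -/
noncomputable def hermiteTwo (x : ℝ) : ℝ := (x ^ 2 - 1) / √2

theorem continuous_hermiteTwo : Continuous hermiteTwo := by
  unfold hermiteTwo; fun_prop

@[fun_prop]
theorem measurable_hermiteTwo : Measurable hermiteTwo := continuous_hermiteTwo.measurable

/-- The characteristic function of `(ξ² - 1) / √2`, where `ξ` is standard Gaussian. -/
noncomputable def hermiteTwoCharFun (t : ℝ) : ℂ :=
  charFun ((gaussianReal 0 1).map hermiteTwo) t

instance isProbabilityMeasure_map_hermiteTwo :
    IsProbabilityMeasure ((gaussianReal 0 1).map hermiteTwo) :=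
  Measure.isProbabilityMeasure_map measurable_hermiteTwo.aemeasurable

@[simp]
theorem hermiteTwoCharFun_zero : hermiteTwoCharFun 0 = 1 := by
  simp [hermiteTwoCharFun]

theorem norm_hermiteTwoCharFun_le_one (t : ℝ) : ‖hermiteTwoCharFun t‖ ≤ 1 :=
  norm_charFun_le_one _

theorem continuous_hermiteTwoCharFun : Continuous hermiteTwoCharFun := by
  unfold hermiteTwoCharFun; fun_prop

theorem integral_sq_gaussianReal : ∫ x, x ^ 2 ∂(gaussianReal 0 1) = 1 := by
  have h := variance_fun_id_gaussianReal (μ := 0) (v := 1)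
  rw [variance_of_integral_eq_zero (by fun_prop) (by simp)] at h
  simpa using h

theorem integral_pow_four_gaussianReal : ∫ x, x ^ 4 ∂(gaussianReal 0 1) = 3 := by
  rw [integral_gaussianReal_eq_integral_smul one_ne_zero]
  have h1 : ∀ x : ℝ, gaussianPDFReal 0 1 x • x ^ 4 =
      (√(2 * Real.pi))⁻¹ * (|x| ^ (4 : ℝ) * Real.exp (-(1 / 2) * |x| ^ (2 : ℝ))) := by
    intro x
    have e4 : |x| ^ (4 : ℝ) = x ^ 4 := by
      have : |x| ^ (4 : ℝ) = |x| ^ (4 : ℕ) := by exact_mod_cast Real.rpow_natCast |x| 4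
      rw [this, Even.pow_abs (by decide)]
    have e2 : |x| ^ (2 : ℝ) = x ^ 2 := by
      rw [Real.rpow_two, sq_abs]
    rw [e4, e2, gaussianPDFReal]
    simp only [NNReal.coe_one, mul_one, sub_zero, smul_eq_mul]
    rw [show -x ^ 2 / 2 = -(1 / 2) * x ^ 2 by ring]
    ring
  simp_rw [h1]
  rw [integral_const_mul,
    integral_comp_abs (f := fun y => y ^ (4 : ℝ) * Real.exp (-(1 / 2) * y ^ (2 : ℝ))),
    integral_rpow_mul_exp_neg_mul_rpow (by norm_num) (by norm_num) (by norm_num)]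
  have hG : Real.Gamma ((4 + 1) / 2) = 3 / 4 * √Real.pi := by
    rw [show ((4 : ℝ) + 1) / 2 = 3 / 2 + 1 by norm_num, Real.Gamma_add_one (by norm_num),
      show (3 / 2 : ℝ) = 1 / 2 + 1 by norm_num, Real.Gamma_add_one (by norm_num),
      Real.Gamma_one_half_eq]
    ring
  have hp : ((1 : ℝ) / 2) ^ (-(4 + 1) / 2 : ℝ) = 4 * √2 := by
    rw [show (-(4 + 1) / 2 : ℝ) = -(5 / 2) by norm_num, one_div,
      Real.inv_rpow (by norm_num), Real.rpow_neg (by norm_num), inv_inv,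
      show (5 / 2 : ℝ) = 2 + 1 / 2 by norm_num, Real.rpow_add (by norm_num), ← Real.sqrt_eq_rpow]
    norm_num
  rw [hG, hp, Real.sqrt_mul (by norm_num)]
  have : √Real.pi ≠ 0 := by positivity
  field_simp

theorem memLp_hermiteTwo : MemLp hermiteTwo 2 (gaussianReal 0 1) := by
  have h4 : MemLp (id : ℝ → ℝ) 4 (gaussianReal 0 1) := memLp_id_gaussianReal' 4 (by simp)
  have h2 : MemLp (fun x : ℝ => x ^ 2) 2 (gaussianReal 0 1) := by
    rw [memLp_two_iff_integrable_sq (by fun_prop)]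
    have := h4.integrable_norm_rpow (by simp) (by simp)
    refine this.congr (ae_of_all _ fun x => ?_)
    have e : ‖x‖ ^ (ENNReal.toReal 4) = x ^ 4 := by
      have := Real.rpow_natCast ‖x‖ 4
      rw [Real.norm_eq_abs, Even.pow_abs (by decide)] at this
      simpa using this
    simp only [id, e]
    ring
  have := (h2.sub (memLp_const (1 : ℝ))).mul_const (√2)⁻¹
  exact this.congr_norm (by fun_prop) (ae_of_all _ fun x => by simp [hermiteTwo, div_eq_mul_inv])

theorem integral_hermiteTwo : ∫ x, hermiteTwo x ∂(gaussianReal 0 1) = 0 := by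
  have h : Integrable (fun x : ℝ => x ^ 2) (gaussianReal 0 1) :=
    (memLp_id_gaussianReal' 2 (by simp)).integrable_sq
  simp only [hermiteTwo]
  rw [integral_div, integral_sub h (integrable_const _), integral_sq_gaussianReal]
  simp

theorem integral_hermiteTwo_sq : ∫ x, hermiteTwo x ^ 2 ∂(gaussianReal 0 1) = 1 := by
  have h2 : Integrable (fun x : ℝ => 2 * x ^ 2) (gaussianReal 0 1) :=
    (memLp_id_gaussianReal' 2 (by simp)).integrable_sq.const_mul 2
  have h4 : Integrable (fun x : ℝ => x ^ 4) (gaussianReal 0 1) :=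
    .of_integral_ne_zero (by rw [integral_pow_four_gaussianReal]; norm_num)
  have e : ∀ x, hermiteTwo x ^ 2 = (x ^ 4 - 2 * x ^ 2 + 1) / 2 := by
    intro x
    rw [hermiteTwo, div_pow, Real.sq_sqrt (by norm_num)]; ring
  simp_rw [e]
  rw [integral_div, integral_add (f := fun x => x ^ 4 - 2 * x ^ 2) (h4.sub h2) (integrable_const _),
    integral_sub h4 h2, integral_const_mul,
    integral_sq_gaussianReal, integral_pow_four_gaussianReal]
  simp; norm_num

/-- Explicitly, the characteristic function is `exp (-i t / √2) (1 - i √2 t)^(-1/2)`. -/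
theorem norm_hermiteTwoCharFun_pow_four (t : ℝ) :
    ‖hermiteTwoCharFun t‖ ^ 4 * (1 + 2 * t ^ 2) = 1 := by
  set b : ℂ := 1 / 2 - (t / √2 : ℝ) * Complex.I with hb
  have hre : 0 < b.re := by simp [hb]
  have key : hermiteTwoCharFun t =
      ((√(2 * Real.pi))⁻¹ : ℝ) * Complex.exp (-(t / √2 : ℝ) * Complex.I) *
        (Real.pi / b) ^ (1 / 2 : ℂ) := by
    rw [hermiteTwoCharFun, charFun_apply_real, integral_map (by fun_prop) (by fun_prop),
      integral_gaussianReal_eq_integral_smul one_ne_zero, ← integral_gaussian_complex hre,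
      ← integral_const_mul]
    congr 1 with x
    rw [gaussianPDFReal, hermiteTwo]
    simp only [NNReal.coe_one, mul_one, sub_zero]
    rw [Complex.real_smul, Complex.ofReal_mul, Complex.ofReal_exp]
    simp only [mul_assoc, ← Complex.exp_add]
    congr 2
    rw [hb]; push_cast; ring
  have hn : ‖hermiteTwoCharFun t‖ = (√(2 * Real.pi))⁻¹ * √(Real.pi / ‖b‖) := by
    rw [key, norm_mul, norm_mul]
    have h1 : ‖Complex.exp (-(t / √2 : ℝ) * Complex.I)‖ = 1 := by
      rw [← Complex.ofReal_neg]; exact Complex.norm_exp_ofReal_mul_I _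
    have h2 : ‖((Real.pi : ℂ) / b) ^ (1 / 2 : ℂ)‖ = √(Real.pi / ‖b‖) := by
      have := Complex.norm_cpow_real ((Real.pi : ℂ) / b) (1 / 2)
      push_cast at this
      rw [this, Real.sqrt_eq_rpow, norm_div, Complex.norm_real, Real.norm_of_nonneg Real.pi_pos.le]
    rw [h1, h2, Complex.norm_real, mul_one, Real.norm_of_nonneg (by positivity)]
  have hbn : ‖b‖ ^ 2 = 1 / 4 + t ^ 2 / 2 := by
    rw [← Complex.normSq_eq_norm_sq, Complex.normSq_apply]
    simp only [hb, Complex.sub_re, Complex.sub_im, Complex.mul_re, Complex.mul_im,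
      Complex.ofReal_re, Complex.ofReal_im, Complex.I_re, Complex.I_im]
    norm_num
    rw [div_mul_div_comm, Real.mul_self_sqrt (by norm_num)]; ring
  have hb0 : 0 < ‖b‖ := norm_pos_iff.2 fun h => by simp [h] at hre
  have e4 : ∀ y : ℝ, 0 ≤ y → √y ^ 4 = y ^ 2 := fun y hy => by
    rw [show 4 = 2 * 2 by norm_num, pow_mul, Real.sq_sqrt hy]
  rw [hn, mul_pow, inv_pow, e4 _ (by positivity), e4 _ (by positivity), div_pow, hbn]
  have := Real.pi_pos
  field_simp
  ring

/-- Second order comparison with the Gaussian characteristic function of the same variance. -/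
theorem hermiteTwoCharFun_sub_gaussian_isLittleO :
    (fun t : ℝ => hermiteTwoCharFun t - Complex.exp (-(t ^ 2 / 2 : ℝ))) =o[𝓝 0]
      fun t => t ^ 2 := by
  have h1 := taylor_charFun_two (P := gaussianReal 0 1) (X := hermiteTwo)
    (by fun_prop) integral_hermiteTwo (by simpa using integral_hermiteTwo_sq)
  have h2 := taylor_charFun_two (P := gaussianReal 0 1) (X := id)
    (by fun_prop) (by simp) (by simpa using integral_sq_gaussianReal)
  refine (h1.sub h2).congr_left fun t => ?_
  rw [Measure.map_id, charFun_gaussianReal]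
  simp [hermiteTwoCharFun]

theorem exists_hermiteTwoCharFun_sub_gaussian_le {ε : ℝ} (hε : 0 < ε) :
    ∃ δ > 0, ∀ t : ℝ, |t| ≤ δ →
      ‖hermiteTwoCharFun t - Complex.exp (-(t ^ 2 / 2 : ℝ))‖ ≤ ε * t ^ 2 := by
  have h := hermiteTwoCharFun_sub_gaussian_isLittleO.def hε
  obtain ⟨δ, hδ, h⟩ := Metric.eventually_nhds_iff_ball.1 h
  refine ⟨δ / 2, by positivity, fun t ht => ?_⟩
  have := h t (by simpa using ht.trans_lt (half_lt_self hδ))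
  simpa using this

theorem charFun_map_const_mul_hermiteTwo {Ω : Type*} [MeasurableSpace Ω] {P : Measure Ω}
    {ξ : Ω → ℝ} (hξ : HasLaw ξ (gaussianReal 0 1) P) (c t : ℝ) :
    charFun (P.map fun ω => c * hermiteTwo (ξ ω)) t = hermiteTwoCharFun (t * c) := by
  rw [charFun_map_mul_comp, hermiteTwoCharFun, mul_comm, ← hξ.map_eq,
    AEMeasurable.map_map_of_aemeasurable (by fun_prop) hξ.aemeasurable]
  · rfl
  · exact measurable_hermiteTwo.comp_aemeasurable hξ.aemeasurable

theorem charFun_map_sum_hermiteTwo {Ω ι : Type*} [MeasurableSpace Ω] {P : Measure Ω} {ξ : ι → Ω → ℝ}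
    (hξ : ∀ i, HasLaw (ξ i) (gaussianReal 0 1) P) (hind : iIndepFun ξ P) (s : Finset ι) (c : ι → ℝ)
    (t : ℝ) :
    charFun (P.map fun ω => ∑ i ∈ s, c i * hermiteTwo (ξ i ω)) t =
      ∏ i ∈ s, hermiteTwoCharFun (t * c i) := by
  have hm : ∀ i, AEMeasurable (fun ω => c i * hermiteTwo (ξ i ω)) P := fun i =>
    (measurable_hermiteTwo.comp_aemeasurable (hξ i).aemeasurable).const_mul _
  have hi : iIndepFun (fun i ω => c i * hermiteTwo (ξ i ω)) P :=
    hind.comp (fun i x => c i * hermiteTwo x) fun i => by fun_prop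
  rw [iIndepFun.charFun_map_fun_finsetSum_eq_prod (fun i _ => hm i) (hi.restrict s)]
  simp [charFun_map_const_mul_hermiteTwo (hξ _)]

/-! ### Limits of products of characteristic functions -/

theorem norm_prod_sub_prod_le {ι : Type*} (s : Finset ι) (f g : ι → ℂ)
    (hf : ∀ i ∈ s, ‖f i‖ ≤ 1) (hg : ∀ i ∈ s, ‖g i‖ ≤ 1) :
    ‖∏ i ∈ s, f i - ∏ i ∈ s, g i‖ ≤ ∑ i ∈ s, ‖f i - g i‖ := by
  classical
  induction s using Finset.induction_on with
  | empty => simp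
  | insert a s ha ih =>
    rw [Finset.prod_insert ha, Finset.prod_insert ha, Finset.sum_insert ha]
    have hf' : ∀ i ∈ s, ‖f i‖ ≤ 1 := fun i hi => hf i (Finset.mem_insert_of_mem hi)
    have hg' : ∀ i ∈ s, ‖g i‖ ≤ 1 := fun i hi => hg i (Finset.mem_insert_of_mem hi)
    have hP : ‖∏ i ∈ s, f i‖ ≤ 1 := by
      rw [norm_prod]; exact Finset.prod_le_one (fun _ _ => norm_nonneg _) hf'
    calc ‖f a * ∏ i ∈ s, f i - g a * ∏ i ∈ s, g i‖
        = ‖(f a - g a) * ∏ i ∈ s, f i + g a * (∏ i ∈ s, f i - ∏ i ∈ s, g i)‖ := by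
          congr 1; ring
      _ ≤ ‖f a - g a‖ * ‖∏ i ∈ s, f i‖ + ‖g a‖ * ‖∏ i ∈ s, f i - ∏ i ∈ s, g i‖ := by
          refine (norm_add_le _ _).trans_eq ?_
          rw [norm_mul, norm_mul]
      _ ≤ ‖f a - g a‖ * 1 + 1 * ∑ i ∈ s, ‖f i - g i‖ := by
          gcongr
          · exact hg a (Finset.mem_insert_self _ _)
          · exact ih hf' hg'
      _ = _ := by ring

theorem one_add_sum_le_prod_one_add {ι : Type*} (s : Finset ι) (f : ι → ℝ)
    (hf : ∀ i ∈ s, 0 ≤ f i) : 1 + ∑ i ∈ s, f i ≤ ∏ i ∈ s, (1 + f i) := by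
  classical
  induction s using Finset.induction_on with
  | empty => simp
  | insert a s ha ih =>
    rw [Finset.prod_insert ha, Finset.sum_insert ha]
    have ih := ih fun i hi => hf i (Finset.mem_insert_of_mem hi)
    have h1 := hf a (Finset.mem_insert_self _ _)
    have h2 : 0 ≤ ∑ i ∈ s, f i :=
      Finset.sum_nonneg fun i hi => hf i (Finset.mem_insert_of_mem hi)
    nlinarith

/-- A lower bound on the characteristic function of `∑ a k * (ξ k ² - 1) / √2` at one point
bounds its variance `∑ a k ²`. -/
theorem norm_prod_hermiteTwoCharFun_pow_four_le {ι : Type*} (s : Finset ι) (a : ι → ℝ) (t : ℝ) :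
    ‖∏ k ∈ s, hermiteTwoCharFun (t * a k)‖ ^ 4 * (1 + 2 * t ^ 2 * ∑ k ∈ s, a k ^ 2) ≤ 1 := by
  calc _ ≤ ‖∏ k ∈ s, hermiteTwoCharFun (t * a k)‖ ^ 4 * ∏ k ∈ s, (1 + 2 * (t * a k) ^ 2) := by
        gcongr
        refine le_trans (le_of_eq ?_)
          (one_add_sum_le_prod_one_add s (fun k => 2 * (t * a k) ^ 2) fun i _ => by positivity)
        rw [Finset.mul_sum]
        congr 1
        exact Finset.sum_congr rfl fun k _ => by ring
    _ = 1 := by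
        rw [norm_prod, ← Finset.prod_pow, ← Finset.prod_mul_distrib]
        exact Finset.prod_eq_one fun k _ => norm_hermiteTwoCharFun_pow_four _

/-- A finite family is sorted by decreasing modulus and padded with zeros; the conclusion lets the
sorted family replace the original one in any finite product. -/
theorem exists_antitone_rearrangement {m : ℕ} (c : Fin m → ℝ) :
    ∃ a : ℕ → ℝ, (∀ k, m ≤ k → a k = 0) ∧ Antitone (fun k => |a k|) ∧
      ∀ f : ℝ → ℂ, ∏ k ∈ Finset.range m, f (a k) = ∏ i, f (c i) := by
  set σ := Tuple.sort (fun i => -|c i|)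
  have hσ : Monotone ((fun i => -|c i|) ∘ σ) := Tuple.monotone_sort _
  refine ⟨fun k => if h : k < m then c (σ ⟨k, h⟩) else 0, fun k hk => by simp [hk.not_gt],
    fun k l hkl => ?_, fun f => ?_⟩
  · by_cases hl : l < m
    · have hk : k < m := hkl.trans_lt hl
      have := hσ (show (⟨k, hk⟩ : Fin m) ≤ ⟨l, hl⟩ from hkl)
      simpa [hl, hk] using this
    · simp [hl]
  · rw [Finset.prod_range]
    simp only [Fin.is_lt, dite_true, Fin.eta]
    exact Equiv.prod_comp σ fun i => f (c i)

theorem norm_cexp_neg_half_sq_le_one (x : ℝ) : ‖Complex.exp (-(x ^ 2 / 2 : ℝ))‖ ≤ 1 := by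
  rw [← Complex.ofReal_neg, ← Complex.ofReal_exp, Complex.norm_real,
    Real.norm_of_nonneg (Real.exp_pos _).le, Real.exp_le_one_iff]
  have := sq_nonneg x
  linarith

/-- Replacing the factors beyond the `K`-th by Gaussian ones of the same variance. -/
theorem norm_prod_sub_prod_mul_gaussian_le {ε δ t : ℝ} (hε : 0 ≤ ε)
    (hδ : ∀ u : ℝ, |u| ≤ δ →
      ‖hermiteTwoCharFun u - Complex.exp (-(u ^ 2 / 2 : ℝ))‖ ≤ ε * u ^ 2)
    {a : ℕ → ℝ} {K M : ℕ} (hKM : K ≤ M) (ha : ∀ k, K ≤ k → |t * a k| ≤ δ) :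
    ‖∏ k ∈ Finset.range M, hermiteTwoCharFun (t * a k) -
      (∏ k ∈ Finset.range K, hermiteTwoCharFun (t * a k)) *
        Complex.exp (-(t ^ 2 * (∑ k ∈ Finset.range M, a k ^ 2 -
          ∑ k ∈ Finset.range K, a k ^ 2) / 2 : ℝ))‖ ≤
      ε * t ^ 2 * ∑ k ∈ Finset.range M, a k ^ 2 := by
  have hexp : Complex.exp (-(t ^ 2 * (∑ k ∈ Finset.range M, a k ^ 2 -
      ∑ k ∈ Finset.range K, a k ^ 2) / 2 : ℝ)) =
      ∏ k ∈ Finset.Ico K M, Complex.exp (-((t * a k) ^ 2 / 2 : ℝ)) := by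
    rw [← Complex.exp_sum, ← Finset.sum_Ico_eq_sub _ hKM]
    congr 1
    rw [Finset.sum_neg_distrib, ← Complex.ofReal_sum, Finset.mul_sum, Finset.sum_div]
    congr 3
    ext k; ring
  rw [hexp, ← Finset.prod_range_mul_prod_Ico _ hKM, ← mul_sub, norm_mul]
  have h1 : ‖∏ k ∈ Finset.range K, hermiteTwoCharFun (t * a k)‖ ≤ 1 := by
    rw [norm_prod]
    exact Finset.prod_le_one (fun _ _ => norm_nonneg _)
      fun _ _ => norm_hermiteTwoCharFun_le_one _
  calc _ ≤ 1 * ∑ k ∈ Finset.Ico K M, ‖hermiteTwoCharFun (t * a k) -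
          Complex.exp (-((t * a k) ^ 2 / 2 : ℝ))‖ := by
        gcongr
        exact norm_prod_sub_prod_le _ _ _ (fun _ _ => norm_hermiteTwoCharFun_le_one _)
          fun _ _ => norm_cexp_neg_half_sq_le_one _
    _ ≤ ∑ k ∈ Finset.Ico K M, ε * t ^ 2 * a k ^ 2 := by
        rw [one_mul]
        refine Finset.sum_le_sum fun k hk => (hδ _ (ha k (Finset.mem_Ico.1 hk).1)).trans_eq ?_
        ring
    _ ≤ _ := by
        rw [← Finset.mul_sum]
        gcongr
        intro k hk
        exact Finset.mem_range.2 (Finset.mem_Ico.1 hk).2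

/-- If the characteristic functions of the variables `∑_{k < m n} a n k * (ξ k ² - 1) / √2` converge
pointwise to a function which is continuous at `0`, then along a subsequence the coefficients,
sorted by decreasing modulus, converge one by one and their sums of squares converge; the mass lost
in the limit contributes a Gaussian factor. -/
theorem exists_sq_summable_of_tendsto_prod_hermiteTwoCharFun {m : ℕ → ℕ} {a : ℕ → ℕ → ℝ}
    (ha : ∀ n k, m n ≤ k → a n k = 0) (hanti : ∀ n, Antitone fun k => |a n k|) {φ : ℝ → ℂ}
    (hφ : ∀ t, Tendsto (fun n => ∏ k ∈ Finset.range (m n), hermiteTwoCharFun (t * a n k)) atTop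
      (𝓝 (φ t))) (hφ0 : ContinuousAt φ 0) :
    ∃ (b : ℕ → ℝ) (σ : ℝ), Summable (fun k => b k ^ 2) ∧
      ∀ t, Tendsto (fun K => (∏ k ∈ Finset.range K, hermiteTwoCharFun (t * b k)) *
        Complex.exp (-(t ^ 2 * σ ^ 2 / 2 : ℝ))) atTop (𝓝 (φ t)) := by
  set S : ℕ → ℝ := fun n => ∑ k ∈ Finset.range (m n), a n k ^ 2 with hS
  have hSnonneg : ∀ n, 0 ≤ S n := fun n => Finset.sum_nonneg fun _ _ => sq_nonneg _
  have hpartial : ∀ n K, ∑ k ∈ Finset.range K, a n k ^ 2 ≤ S n := by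
    intro n K
    rcases le_total K (m n) with h | h
    · exact Finset.sum_le_sum_of_subset_of_nonneg (Finset.range_mono h) fun _ _ _ => sq_nonneg _
    · refine le_of_eq ?_
      rw [hS, ← Finset.sum_range_add_sum_Ico _ h, Finset.sum_eq_zero (s := Finset.Ico _ _), add_zero]
      intro k hk
      rw [ha n k (Finset.mem_Ico.1 hk).1]; ring
  -- A point `t₀ ≠ 0` where the limit does not vanish gives a bound on the variances.
  obtain ⟨B, hB⟩ : ∃ B, ∀ᶠ n in atTop, S n ≤ B := by
    have hone : φ 0 = 1 := by
      refine tendsto_nhds_unique (hφ 0) ?_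
      simp
    have hne : ∀ᶠ t in 𝓝[≠] (0 : ℝ), φ t ≠ 0 :=
      (hφ0.eventually_ne (by rw [hone]; exact one_ne_zero)).filter_mono nhdsWithin_le_nhds
    obtain ⟨t, ht, ht0⟩ := (hne.and self_mem_nhdsWithin).exists
    have ht0 : t ≠ 0 := ht0
    set c := ‖φ t‖ / 2 with hc
    have hcpos : 0 < c := by positivity
    have hlim := (hφ t).norm.eventually_const_lt (half_lt_self (norm_pos_iff.2 ht))
    refine ⟨1 / (c ^ 4 * (2 * t ^ 2)), hlim.mono fun n hn => ?_⟩
    have h4 := norm_prod_hermiteTwoCharFun_pow_four_le (Finset.range (m n)) (a n) t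
    rw [le_div_iff₀ (by positivity)]
    have hc4 : c ^ 4 ≤ ‖∏ k ∈ Finset.range (m n), hermiteTwoCharFun (t * a n k)‖ ^ 4 := by
      gcongr
    have hSn := hSnonneg n
    calc S n * (c ^ 4 * (2 * t ^ 2)) ≤ c ^ 4 * (1 + 2 * t ^ 2 * S n) := by
          nlinarith [pow_pos hcpos 4]
      _ ≤ _ := by
          refine le_trans ?_ h4
          gcongr
  obtain ⟨n₀, hB⟩ := eventually_atTop.1 hB
  have hB0 : 0 ≤ B := (hSnonneg n₀).trans (hB n₀ le_rfl)
  -- Extraction of a subsequence, by compactness of a countable product of intervals.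
  obtain ⟨⟨b, T⟩, -, ψ, hψ, hlim⟩ :
      ∃ p ∈ (Set.univ.pi fun _ : ℕ => Set.Icc (-√B) √B) ×ˢ Set.Icc 0 B,
        ∃ ψ : ℕ → ℕ, StrictMono ψ ∧
          Tendsto ((fun n => (a (n₀ + n), S (n₀ + n))) ∘ ψ) atTop (𝓝 p) := by
    refine ((isCompact_univ_pi fun _ => isCompact_Icc).prod isCompact_Icc).tendsto_subseq
      fun n => ⟨fun k _ => ?_, hSnonneg _, hB _ (Nat.le_add_right _ _)⟩
    refine abs_le.1 (Real.abs_le_sqrt ?_)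
    refine le_trans ?_ ((hpartial (n₀ + n) (k + 1)).trans (hB _ (Nat.le_add_right _ _)))
    rw [Finset.sum_range_succ]
    have : 0 ≤ ∑ j ∈ Finset.range k, a (n₀ + n) j ^ 2 := Finset.sum_nonneg fun _ _ => sq_nonneg _
    linarith
  set ν : ℕ → ℕ := fun j => n₀ + ψ j with hν
  have hνlim : Tendsto ν atTop atTop :=
    tendsto_atTop_mono (fun j => Nat.le_add_left _ _) hψ.tendsto_atTop
  have hνB : ∀ j, S (ν j) ≤ B := fun j => hB _ (Nat.le_add_right _ _)
  have hlimS : Tendsto (fun j => S (ν j)) atTop (𝓝 T) :=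
    (continuous_snd.tendsto _).comp hlim
  have hlima : ∀ k, Tendsto (fun j => a (ν j) k) atTop (𝓝 (b k)) := fun k =>
    (((continuous_apply k).comp continuous_fst).tendsto _).comp hlim
  have hlimsq : ∀ K, Tendsto (fun j => ∑ k ∈ Finset.range K, a (ν j) k ^ 2) atTop
      (𝓝 (∑ k ∈ Finset.range K, b k ^ 2)) := fun K =>
    tendsto_finsetSum _ fun k _ => (hlima k).pow 2
  have hbT : ∀ K, ∑ k ∈ Finset.range K, b k ^ 2 ≤ T := fun K =>
    le_of_tendsto_of_tendsto' (hlimsq K) hlimS fun j => hpartial _ _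
  have hsum : Summable fun k => b k ^ 2 :=
    summable_of_sum_range_le (fun _ => sq_nonneg _) hbT
  have hT : ∑' k, b k ^ 2 ≤ T := Real.tsum_le_of_sum_range_le (fun _ => sq_nonneg _) hbT
  refine ⟨b, √(T - ∑' k, b k ^ 2), hsum, fun t => ?_⟩
  rw [Real.sq_sqrt (by linarith)]
  -- Comparison with the limit, with the Gaussian variance computed from the first `K` coefficients.
  have hmain : Tendsto (fun K => (∏ k ∈ Finset.range K, hermiteTwoCharFun (t * b k)) *
      Complex.exp (-(t ^ 2 * (T - ∑ k ∈ Finset.range K, b k ^ 2) / 2 : ℝ))) atTop (𝓝 (φ t)) := by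
    rw [tendsto_iff_norm_sub_tendsto_zero]
    rw [Metric.tendsto_atTop]
    intro η hη
    set ε := η / (2 * (t ^ 2 * B + 1)) with hε
    have hden : 0 < 2 * (t ^ 2 * B + 1) := by positivity
    have hεpos : 0 < ε := by positivity
    have hεη : ε * t ^ 2 * B < η := by
      have h1 : ε * (2 * (t ^ 2 * B + 1)) = η := div_mul_cancel₀ _ hden.ne'
      have h2 : 0 ≤ t ^ 2 * B := by positivity
      nlinarith
    obtain ⟨δ, hδpos, hδ⟩ := exists_hermiteTwoCharFun_sub_gaussian_le hεpos
    obtain ⟨K₀, hK₀⟩ := exists_nat_gt (t ^ 2 * B / δ ^ 2)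
    refine ⟨K₀, fun K hK => ?_⟩
    rw [dist_zero_right, norm_norm, norm_sub_rev]
    refine lt_of_le_of_lt ?_ hεη
    -- In a decreasing sequence, the `K`-th term is at most `√(B / K)`.
    have hsmall : ∀ j k, K ≤ k → |t * a (ν j) k| ≤ δ := by
      intro j k hk
      have h1 : (K : ℝ) * a (ν j) k ^ 2 ≤ B := by
        calc (K : ℝ) * a (ν j) k ^ 2 = ∑ i ∈ Finset.range K, a (ν j) k ^ 2 := by simp
          _ ≤ ∑ i ∈ Finset.range K, a (ν j) i ^ 2 := by
              refine Finset.sum_le_sum fun i hi => sq_le_sq.2 (hanti _ ?_)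
              exact (Finset.mem_range.1 hi).le.trans hk
          _ ≤ B := (hpartial _ _).trans (hνB j)
      have h2 : t ^ 2 * B / δ ^ 2 < K := hK₀.trans_le (by exact_mod_cast hK)
      rw [div_lt_iff₀ (by positivity)] at h2
      refine abs_le_of_sq_le_sq ?_ hδpos.le
      by_contra! h3
      have h4 : (K : ℝ) * δ ^ 2 ≤ K * (t * a (ν j) k) ^ 2 := by gcongr
      have h5 : (K : ℝ) * (t * a (ν j) k) ^ 2 ≤ t ^ 2 * B := by
        calc _ = t ^ 2 * (K * a (ν j) k ^ 2) := by ring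
          _ ≤ _ := by gcongr
      linarith
    have hleft : Tendsto (fun j => ‖∏ k ∈ Finset.range (m (ν j)), hermiteTwoCharFun (t * a (ν j) k) -
        (∏ k ∈ Finset.range K, hermiteTwoCharFun (t * a (ν j) k)) *
          Complex.exp (-(t ^ 2 * (S (ν j) - ∑ k ∈ Finset.range K, a (ν j) k ^ 2) / 2 : ℝ))‖) atTop
        (𝓝 ‖φ t - (∏ k ∈ Finset.range K, hermiteTwoCharFun (t * b k)) *
          Complex.exp (-(t ^ 2 * (T - ∑ k ∈ Finset.range K, b k ^ 2) / 2 : ℝ))‖) := by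
      refine (((hφ t).comp hνlim).sub (Tendsto.mul ?_ ?_)).norm
      · exact tendsto_finsetProd _ fun k _ =>
          (continuous_hermiteTwoCharFun.tendsto _).comp ((hlima k).const_mul t)
      · refine (Complex.continuous_exp.tendsto _).comp (Tendsto.neg ?_)
        exact (Complex.continuous_ofReal.tendsto _).comp
          (((hlimS.sub (hlimsq K)).const_mul _).div_const _)
    refine le_of_tendsto' hleft fun j => ?_
    -- Padding by the zero coefficients beyond `m`.
    have hpad : ∏ k ∈ Finset.range (max K (m (ν j))), hermiteTwoCharFun (t * a (ν j) k) =
        ∏ k ∈ Finset.range (m (ν j)), hermiteTwoCharFun (t * a (ν j) k) := by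
      rw [← Finset.prod_range_mul_prod_Ico _ (le_max_right K (m (ν j))),
        Finset.prod_eq_one (s := Finset.Ico _ _), mul_one]
      intro k hk
      rw [ha _ k (Finset.mem_Ico.1 hk).1]; simp
    have hpad' : ∑ k ∈ Finset.range (max K (m (ν j))), a (ν j) k ^ 2 = S (ν j) :=
      le_antisymm (hpartial _ _) (Finset.sum_le_sum_of_subset_of_nonneg
        (Finset.range_mono (le_max_right _ _)) fun _ _ _ => sq_nonneg _)
    have := norm_prod_sub_prod_mul_gaussian_le hεpos.le hδ (le_max_left K (m (ν j))) (hsmall j)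
    rw [hpad, hpad'] at this
    refine this.trans ?_
    gcongr
    exact hνB j
  have hratio : Tendsto (fun K => Complex.exp ((t ^ 2 * (∑' k, b k ^ 2 -
      ∑ k ∈ Finset.range K, b k ^ 2) / 2 : ℝ))) atTop (𝓝 1) := by
    have h0 : Tendsto (fun K => (t ^ 2 * (∑' k, b k ^ 2 -
      ∑ k ∈ Finset.range K, b k ^ 2) / 2 : ℝ)) atTop (𝓝 0) := by
      have := ((hsum.hasSum.tendsto_sum_nat.const_sub (∑' k, b k ^ 2)).const_mul (t ^ 2)).div_const 2
      simpa using this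
    have := (Complex.continuous_exp.tendsto _).comp
      ((Complex.continuous_ofReal.tendsto _).comp h0)
    simpa [Function.comp_def] using this
  have := hmain.mul hratio
  rw [mul_one] at this
  refine this.congr fun K => ?_
  rw [mul_assoc, ← Complex.exp_add]
  congr 2
  push_cast; ring

/-! ### The law of an elementary double integral -/

/-- A quadratic form evaluated at a vector written in an orthonormal basis of eigenvectors. -/
theorem Matrix.IsHermitian.sum_mul_mul_eigenvectorBasis {ι : Type*} [Fintype ι] [DecidableEq ι]
    {B : Matrix ι ι ℝ} (hB : B.IsHermitian) (x : ι → ℝ) :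
    ∑ i, ∑ j, B i j * ((∑ k, x k • hB.eigenvectorBasis k) i *
      (∑ k, x k • hB.eigenvectorBasis k) j) = ∑ k, hB.eigenvalues k * x k ^ 2 := by
  set u := hB.eigenvectorBasis with hu
  set v := ∑ k, x k • u k with hv
  have h1 : Matrix.toEuclideanLin B v = ∑ k, (hB.eigenvalues k * x k) • u k := by
    rw [hv, map_sum]
    refine Finset.sum_congr rfl fun k _ => ?_
    rw [map_smul]
    have : Matrix.toEuclideanLin B (u k) = hB.eigenvalues k • u k := by
      ext i
      have := congrFun (hB.mulVec_eigenvectorBasis k) i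
      simpa [Matrix.toLpLin_apply] using this
    rw [this, smul_smul, mul_comm]
  have h2 : inner ℝ v (Matrix.toEuclideanLin B v) = ∑ k, hB.eigenvalues k * x k ^ 2 := by
    rw [h1, hv, u.orthonormal.inner_sum]
    refine Finset.sum_congr rfl fun k _ => ?_
    simp; ring
  rw [← h2, PiLp.inner_apply]
  refine Finset.sum_congr rfl fun i _ => ?_
  simp only [Matrix.toLpLin_apply, Matrix.mulVec, dotProduct, RCLike.inner_apply, conj_trivial,
    Finset.sum_mul]
  refine Finset.sum_congr rfl fun j _ => ?_
  ring

/-- A traceless quadratic form in independent standard Gaussian variables has, after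
diagonalization, the law of a linear combination of independent copies of `(ξ² - 1) / √2`. -/
theorem exists_charFun_map_quadratic_eq_prod {ι : Type*} [Fintype ι] [DecidableEq ι]
    {B : Matrix ι ι ℝ} (hB : B.IsHermitian) (htr : B.trace = 0) :
    ∃ c : ι → ℝ, ∀ t, charFun ((Measure.pi fun _ : ι => gaussianReal 0 1).map
      fun x => ∑ i, ∑ j, B i j * (x i * x j)) t = ∏ i, hermiteTwoCharFun (t * c i) := by
  set γ := Measure.pi fun _ : ι => gaussianReal 0 1 with hγ
  refine ⟨fun i => √2 * hB.eigenvalues i, fun t => ?_⟩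
  have hrot : γ.map (WithLp.toLp 2) = γ.map fun x => ∑ k, x k • hB.eigenvectorBasis k := by
    rw [map_pi_eq_stdGaussian, ← stdGaussian_eq_map_pi_orthonormalBasis]
  set q : EuclideanSpace ℝ ι → ℝ := fun v => ∑ i, ∑ j, B i j * (v i * v j) with hq
  have hqm : Measurable q := by fun_prop
  have hmap : γ.map (fun x => ∑ i, ∑ j, B i j * (x i * x j)) =
      γ.map fun x => ∑ k, (√2 * hB.eigenvalues k) * hermiteTwo (x k) := by
    have := congrArg (Measure.map q) hrot
    rw [Measure.map_map hqm (by fun_prop), Measure.map_map hqm (by fun_prop)] at this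
    refine this.trans ?_
    congr 1 with x
    have htr' : ∑ k, hB.eigenvalues k = 0 := by
      have := hB.trace_eq_sum_eigenvalues
      rw [htr] at this
      simpa using this.symm
    simp only [Function.comp_apply, hq, hB.sum_mul_mul_eigenvectorBasis]
    rw [← sub_zero (∑ k, _), ← htr', ← Finset.sum_sub_distrib]
    refine Finset.sum_congr rfl fun k _ => ?_
    rw [hermiteTwo]
    field_simp
  rw [hmap]
  exact charFun_map_sum_hermiteTwo (P := γ) (ξ := fun i x => x i)
    (fun i => (measurePreserving_eval (fun _ : ι => gaussianReal 0 1) i).hasLaw)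
    (iIndepFun_pi (X := fun _ => id) fun _ => aemeasurable_id) Finset.univ _ t

theorem hasLaw_increment {Ω : Type*} [MeasurableSpace Ω] {P : Measure Ω} {W : ℝ≥0 → Ω → ℝ}
    (hW : IsPreBrownianReal W P) {a b : ℝ≥0} (hab : a ≤ b) :
    HasLaw (fun ω => W b ω - W a ω) (gaussianReal 0 (b - a)) P := by
  have h := hW.hasLaw_sub b a
  have e : nndist b.1 a.1 = b - a := by
    have h1 : nndist b a = nndist b.1 a.1 := rfl
    rw [← h1, NNReal.nndist_eq, tsub_eq_zero_of_le hab, max_eq_left zero_le]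
  rw [e] at h
  exact h

/-- The increments of a Brownian motion over a partition have the law of a standard Gaussian vector
with rescaled coordinates. -/
theorem map_increments_eq {Ω : Type*} [MeasurableSpace Ω] {P : Measure Ω} [IsProbabilityMeasure P]
    {W : ℝ≥0 → Ω → ℝ} (hW : IsPreBrownianReal W P) {m : ℕ} {t : Fin (m + 1) → ℝ≥0}
    (ht : Monotone t) :
    P.map (fun ω i => W (t (Fin.succ i)) ω - W (t (Fin.castSucc i)) ω) =
      (Measure.pi fun _ : Fin m => gaussianReal 0 1).map
        fun x i => √((t i.succ - t i.castSucc : ℝ≥0) : ℝ) * x i := by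
  have hle : ∀ i : Fin m, t i.castSucc ≤ t i.succ := fun i => ht i.castSucc_le_succ
  have hind := hW.hasIndepIncrements m t ht
  rw [(iIndepFun_iff_map_fun_eq_pi_map fun i => (hasLaw_increment hW (hle i)).aemeasurable).1 hind,
    Measure.pi_map_pi (μ := fun _ : Fin m => gaussianReal 0 1)
      (f := fun i (y : ℝ) => √((t i.succ - t i.castSucc : ℝ≥0) : ℝ) * y) fun i => by fun_prop]
  congr 1 with i : 1
  rw [(hasLaw_increment hW (hle i)).map_eq, gaussianReal_map_const_mul]
  congr 1
  · simp
  · ext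
    simp [Real.sq_sqrt]

theorem OffDiagStep.aemeasurable_integral {Ω : Type*} [MeasurableSpace Ω] {P : Measure Ω}
    {W : ℝ≥0 → Ω → ℝ} (hW : ∀ t, AEMeasurable (W t) P) (s : OffDiagStep) :
    AEMeasurable (s.integral W) P := by
  unfold OffDiagStep.integral
  fun_prop

theorem OffDiagStep.exists_charFun_integral_eq_prod {Ω : Type*} [MeasurableSpace Ω] {P : Measure Ω}
    [IsProbabilityMeasure P] {W : ℝ≥0 → Ω → ℝ} (hW : IsPreBrownianReal W P) (s : OffDiagStep) :
    ∃ c : Fin s.m → ℝ, ∀ t,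
      charFun (P.map (s.integral W)) t = ∏ i, hermiteTwoCharFun (t * c i) := by
  set r : Fin s.m → ℝ := fun i => √((s.t i.succ - s.t i.castSucc : ℝ≥0) : ℝ) with hr
  set B : Matrix (Fin s.m) (Fin s.m) ℝ := .of fun i j => s.coeff i j * (r i * r j) with hBdef
  have hB : B.IsHermitian := by
    ext i j
    simp only [Matrix.conjTranspose_apply, hBdef, star_trivial, Matrix.of_apply]
    rw [s.symm.apply, mul_comm (r j)]
  have htr : B.trace = 0 := Finset.sum_eq_zero fun i _ => by simp [hBdef, s.diag]
  obtain ⟨c, hc⟩ := exists_charFun_map_quadratic_eq_prod hB htr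
  refine ⟨c, fun t => ?_⟩
  rw [← hc]
  have hm : AEMeasurable (fun ω i => W (s.t (Fin.succ i)) ω - W (s.t (Fin.castSucc i)) ω) P :=
    aemeasurable_pi_lambda _ fun i => (hW.aemeasurable _).sub (hW.aemeasurable _)
  set q : (Fin s.m → ℝ) → ℝ := fun x => ∑ i, ∑ j, s.coeff i j * (x i * x j) with hq
  have hqm : Measurable q := by fun_prop
  have h1 := congrArg (Measure.map q) (map_increments_eq hW s.mono)
  rw [AEMeasurable.map_map_of_aemeasurable hqm.aemeasurable hm,
    Measure.map_map hqm (by fun_prop)] at h1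
  have h2 : P.map (s.integral W) = _ := h1
  rw [h2]
  congr 2
  ext x
  simp only [Function.comp_apply, hq, hBdef, hr, Matrix.of_apply]
  refine Finset.sum_congr rfl fun i _ => Finset.sum_congr rfl fun j _ => ?_
  ring

/-! ### Orthonormal sequences of functions -/

theorem tendsto_eLpNorm_two_of_integral_sq {α : Type*} [MeasurableSpace α] {μ : Measure α}
    {g : ℕ → α → ℝ} (hg : ∀ n, MemLp (g n) 2 μ)
    (h : Tendsto (fun n => ∫ x, g n x ^ 2 ∂μ) atTop (𝓝 0)) :
    Tendsto (fun n => eLpNorm (g n) 2 μ) atTop (𝓝 0) := by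
  have e : ∀ n, eLpNorm (g n) 2 μ = ENNReal.ofReal (√(∫ x, g n x ^ 2 ∂μ)) := by
    intro n
    rw [(hg n).eLpNorm_eq_integral_rpow_norm (by simp) (by simp)]
    congr 1
    rw [Real.sqrt_eq_rpow]
    simp
  simp_rw [e]
  have := ENNReal.tendsto_ofReal ((Real.continuous_sqrt.tendsto _).comp h)
  simpa using this

theorem integral_sq_sum_of_orthonormal {α ι : Type*} [MeasurableSpace α] {μ : Measure α}
    [DecidableEq ι] {y : ι → α → ℝ} (hy : ∀ k, MemLp (y k) 2 μ)
    (horth : ∀ j k, ∫ x, y j x * y k x ∂μ = if j = k then 1 else 0) (s : Finset ι) (c : ι → ℝ) :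
    ∫ x, (∑ k ∈ s, c k * y k x) ^ 2 ∂μ = ∑ k ∈ s, c k ^ 2 := by
  have e : ∀ x, (∑ k ∈ s, c k * y k x) ^ 2 =
      ∑ j ∈ s, ∑ k ∈ s, (c j * c k) * (y j x * y k x) := by
    intro x
    rw [sq, Finset.sum_mul_sum]
    exact Finset.sum_congr rfl fun j _ => Finset.sum_congr rfl fun k _ => by ring
  have hi : ∀ j k, Integrable (fun x => (c j * c k) * (y j x * y k x)) μ := fun j k =>
    ((hy j).integrable_mul (hy k)).const_mul _
  simp_rw [e]
  rw [integral_finsetSum _ fun j _ => integrable_finsetSum _ fun k _ => hi j k]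
  refine Finset.sum_congr rfl fun j hj => ?_
  rw [integral_finsetSum _ fun k _ => hi j k]
  simp_rw [integral_const_mul, horth]
  simp [hj, sq]

theorem exists_tendsto_eLpNorm_sum_of_orthonormal {α : Type*} [MeasurableSpace α] {μ : Measure α}
    {y : ℕ → α → ℝ} (hy : ∀ k, MemLp (y k) 2 μ)
    (horth : ∀ j k, ∫ x, y j x * y k x ∂μ = if j = k then 1 else 0) {c : ℕ → ℝ}
    (hc : Summable fun k => c k ^ 2) :
    ∃ g : α → ℝ, MemLp g 2 μ ∧ Tendsto
      (fun N => eLpNorm (fun x => ∑ k ∈ Finset.range N, c k * y k x - g x) 2 μ) atTop (𝓝 0) := by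
  set v : ℕ → Lp ℝ 2 μ := fun k => (hy k).toLp (y k) with hv
  have hvo : Orthonormal ℝ v := by
    rw [orthonormal_iff_ite]
    intro j k
    rw [L2.inner_def, ← horth]
    refine integral_congr_ae ?_
    filter_upwards [(hy j).coeFn_toLp, (hy k).coeFn_toLp] with x h1 h2
    simp only [hv]
    rw [h1, h2]
    simp [mul_comm]
  have hsum : Summable fun k => c k • v k := by
    have := (hvo.orthogonalFamily.summable_iff_norm_sq_summable (fun k => c k)).2 (by simpa using hc)
    simpa using this
  have hlim := hsum.hasSum.tendsto_sum_nat
  set g := ∑' k, c k • v k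
  refine ⟨g, Lp.memLp g, ?_⟩
  rw [Lp.tendsto_Lp_iff_tendsto_eLpNorm'] at hlim
  refine hlim.congr fun N => eLpNorm_congr_ae ?_
  have hcoe : ∀ N : ℕ, ((∑ k ∈ Finset.range N, c k • v k : Lp ℝ 2 μ) : α → ℝ) =ᵐ[μ]
      fun x => ∑ k ∈ Finset.range N, c k * y k x := by
    intro N
    induction N with
    | zero =>
      simp only [Finset.range_zero, Finset.sum_empty]
      exact Lp.coeFn_zero ℝ 2 μ
    | succ N ih =>
      simp only [Finset.sum_range_succ]
      filter_upwards [Lp.coeFn_add (∑ k ∈ Finset.range N, c k • v k) (c N • v N), ih,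
        Lp.coeFn_smul (c N) (v N), (hy N).coeFn_toLp] with x h1 h2 h3 h4
      rw [h1, Pi.add_apply, h2, h3, Pi.smul_apply, h4, smul_eq_mul]
  filter_upwards [hcoe N] with x hx
  rw [Pi.sub_apply, hx]

/-! ### Closure of double integrals under limits -/

theorem OffDiagStep.measurable_toFun (s : OffDiagStep) : Measurable s.toFun := by
  have h : ∀ i, Measurable ((s.cell i).indicator (1 : ℝ≥0 → ℝ)) := fun i =>
    measurable_one.indicator measurableSet_Ioc
  unfold OffDiagStep.toFun
  fun_prop

theorem ae_symm_of_tendsto_eLpNorm {μ : Measure ℝ≥0} [SigmaFinite μ]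
    {f : ℝ≥0 × ℝ≥0 → ℝ} {u : ℕ → ℝ≥0 × ℝ≥0 → ℝ} (hu : ∀ n, MemLp (u n) 2 (μ.prod μ))
    (husymm : ∀ n, ∀ᵐ p ∂(μ.prod μ), u n p.swap = u n p) (hf : MemLp f 2 (μ.prod μ))
    (h : Tendsto (fun n => eLpNorm (fun p => u n p - f p) 2 (μ.prod μ)) atTop (𝓝 0)) :
    ∀ᵐ p ∂(μ.prod μ), f p.swap = f p := by
  have hm := tendstoInMeasure_of_tendsto_eLpNorm (by simp) (fun n => (hu n).aestronglyMeasurable)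
    hf.aestronglyMeasurable h
  obtain ⟨ns, -, hae⟩ := hm.exists_seq_tendsto_ae
  have hswap : ∀ᵐ p ∂(μ.prod μ), Tendsto (fun i => u (ns i) p.swap) atTop (𝓝 (f p.swap)) :=
    (Measure.measurePreserving_swap (μ := μ) (ν := μ)).quasiMeasurePreserving.ae hae
  filter_upwards [hae, hswap, ae_all_iff.2 husymm] with p h1 h2 h3
  simp_rw [h3] at h2
  exact tendsto_nhds_unique h2 h1

theorem IsDoubleWienerIntegral.of_tendsto {Ω : Type*} [MeasurableSpace Ω] {W : ℝ≥0 → Ω → ℝ}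
    {P : Measure Ω} (hW : ∀ t, AEMeasurable (W t) P)
    {u : ℕ → ℝ≥0 × ℝ≥0 → ℝ} {H : ℕ → Ω → ℝ}
    (h : ∀ n, IsDoubleWienerIntegral W P (u n) (H n)) {f : ℝ≥0 × ℝ≥0 → ℝ} {G : Ω → ℝ}
    (hf : MemLp f 2 (lebesgueNNReal.prod lebesgueNNReal)) (hG : MemLp G 2 P)
    (huf : Tendsto (fun n => eLpNorm (fun p => u n p - f p) 2
      (lebesgueNNReal.prod lebesgueNNReal)) atTop (𝓝 0))
    (hHG : Tendsto (fun n => eLpNorm (fun ω => H n ω - G ω) 2 P) atTop (𝓝 0)) :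
    IsDoubleWienerIntegral W P f G where
  isSymmL2 := ⟨hf, ae_symm_of_tendsto_eLpNorm (fun n => (h n).isSymmL2.memLp)
    (fun n => (h n).isSymmL2.symm) hf huf⟩
  memLp := hG
  exists_approx := by
    have hs : ∀ n : ℕ, ∃ s : OffDiagStep,
        eLpNorm (fun p => s.toFun p - u n p) 2 (lebesgueNNReal.prod lebesgueNNReal) ≤
          ((n : ℝ≥0∞) + 1)⁻¹ ∧
        eLpNorm (fun ω => s.integral W ω - H n ω) 2 P ≤ ((n : ℝ≥0∞) + 1)⁻¹ := by
      intro n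
      obtain ⟨s, h1, h2⟩ := (h n).exists_approx
      have hpos : (0 : ℝ≥0∞) < ((n : ℝ≥0∞) + 1)⁻¹ := by
        simp
      obtain ⟨k, hk⟩ := ((h1.eventually_le_const hpos).and (h2.eventually_le_const hpos)).exists
      exact ⟨s k, hk⟩
    choose s hs1 hs2 using hs
    have hlim : Tendsto (fun n : ℕ => ((n : ℝ≥0∞) + 1)⁻¹) atTop (𝓝 0) := by
      have := ENNReal.tendsto_inv_nat_nhds_zero.comp (tendsto_add_atTop_nat 1)
      simpa [Function.comp_def] using this
    refine ⟨s, ?_, ?_⟩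
    · refine tendsto_of_tendsto_of_tendsto_of_le_of_le tendsto_const_nhds
        (by simpa using hlim.add huf) (fun _ => zero_le) fun n => ?_
      calc _ = eLpNorm ((fun p => (s n).toFun p - u n p) + fun p => u n p - f p) 2
              (lebesgueNNReal.prod lebesgueNNReal) := by
            congr 1; ext p; simp
        _ ≤ _ := eLpNorm_add_le
            ((s n).measurable_toFun.aestronglyMeasurable.sub
              (h n).isSymmL2.memLp.aestronglyMeasurable)
            ((h n).isSymmL2.memLp.aestronglyMeasurable.sub hf.aestronglyMeasurable) (by norm_num)
        _ ≤ _ := by gcongr; exact hs1 n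
    · refine tendsto_of_tendsto_of_tendsto_of_le_of_le tendsto_const_nhds
        (by simpa using hlim.add hHG) (fun _ => zero_le) fun n => ?_
      calc _ = eLpNorm ((fun ω => (s n).integral W ω - H n ω) + fun ω => H n ω - G ω) 2 P := by
            congr 1; ext p; simp
        _ ≤ _ := eLpNorm_add_le
            (((s n).aemeasurable_integral hW).aestronglyMeasurable.sub
              (h n).memLp.aestronglyMeasurable)
            ((h n).memLp.aestronglyMeasurable.sub hG.aestronglyMeasurable) (by norm_num)
        _ ≤ _ := by gcongr; exact hs2 n

/-! ### Double integrals of kernels carried by unit diagonal squares -/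

/-- The indicator function of the diagonal square `(k, k+1]²`. -/
noncomputable def unitSquare (k : ℕ) (p : ℝ≥0 × ℝ≥0) : ℝ :=
  (Set.Ioc (k : ℝ≥0) (k + 1)).indicator 1 p.1 * (Set.Ioc (k : ℝ≥0) (k + 1)).indicator 1 p.2

/-- The grid `0, 1/m, 2/m, …, N`, where each of the intervals `(k, k+1]` with `k < N` is cut into
`m` cells, with the value `c k` on the off-diagonal cells of the square `(k, k+1]²` and `0`
elsewhere. Cells are indexed by pairs `(k, j)` through `finProdFinEquiv`. -/
noncomputable def blockStep (N m : ℕ) (c : ℕ → ℝ) : OffDiagStep where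
  m := N * m
  t i := (i : ℕ) / m
  mono := fun i j hij => by
    have : ((i : ℕ) : ℝ≥0) ≤ (j : ℕ) := by exact_mod_cast hij
    change ((i : ℕ) : ℝ≥0) / m ≤ (j : ℕ) / m
    gcongr
  coeff := .of fun i j =>
    if (finProdFinEquiv.symm i).1 = (finProdFinEquiv.symm j).1 ∧ i ≠ j then
      c (finProdFinEquiv.symm i).1 else 0
  symm := by
    ext i j
    simp only [Matrix.transpose_apply, Matrix.of_apply]
    split_ifs with h1 h2 h2
    · rw [h1.1]
    · exact absurd ⟨h1.1.symm, h1.2.symm⟩ h2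
    · exact absurd ⟨h2.1.symm, h2.2.symm⟩ h1
    · rfl
  diag i := by simp

/-- Off-diagonal double sums, block by block, as products minus diagonal sums. -/
theorem sum_blockStep_coeff_mul {N m : ℕ} (c : ℕ → ℝ) (x y : Fin (N * m) → ℝ) :
    ∑ i, ∑ j, (blockStep N m c).coeff i j * (x i * y j) =
      ∑ k : Fin N, c k * ((∑ j, x (finProdFinEquiv (k, j))) * (∑ j, y (finProdFinEquiv (k, j)))) -
        ∑ i, c (finProdFinEquiv.symm i).1 * (x i * y i) := by
  have h1 : ∀ i j : Fin (N * m), (blockStep N m c).coeff i j * (x i * y j) =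
      (if (finProdFinEquiv.symm i).1 = (finProdFinEquiv.symm j).1 then
        c (finProdFinEquiv.symm i).1 * (x i * y j) else 0) -
      if i = j then c (finProdFinEquiv.symm i).1 * (x i * y j) else 0 := by
    intro i j
    rw [show (blockStep N m c).coeff i j =
      if (finProdFinEquiv.symm i).1 = (finProdFinEquiv.symm j).1 ∧ i ≠ j then
        c (finProdFinEquiv.symm i).1 else 0 from rfl]
    by_cases hij : i = j
    · simp [hij]
    · simp [hij]
  have h2 : ∑ i, ∑ j, (blockStep N m c).coeff i j * (x i * y j) = ∑ i : Fin (N * m),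
      ∑ j : Fin (N * m), ((if (finProdFinEquiv.symm i).1 = (finProdFinEquiv.symm j).1 then
        c (finProdFinEquiv.symm i).1 * (x i * y j) else 0) -
      if i = j then c (finProdFinEquiv.symm i).1 * (x i * y j) else 0) :=
    Finset.sum_congr rfl fun i _ => Finset.sum_congr rfl fun j _ => h1 i j
  rw [h2]
  simp only [Finset.sum_sub_distrib, Finset.sum_ite_eq, Finset.mem_univ, if_true]
  congr 1
  rw [← Equiv.sum_comp finProdFinEquiv, Fintype.sum_prod_type]
  refine Finset.sum_congr rfl fun k _ => ?_
  have h3 : ∀ j : Fin m, ∑ i : Fin (N * m), (if (finProdFinEquiv.symm (finProdFinEquiv (k, j))).1 =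
      (finProdFinEquiv.symm i).1 then c (finProdFinEquiv.symm (finProdFinEquiv (k, j))).1 *
        (x (finProdFinEquiv (k, j)) * y i) else 0) =
      ∑ l, c k * (x (finProdFinEquiv (k, j)) * y (finProdFinEquiv (k, l))) := by
    intro j
    rw [← Equiv.sum_comp finProdFinEquiv, Fintype.sum_prod_type]
    simp only [Equiv.symm_apply_apply]
    rw [Finset.sum_eq_single k]
    · simp
    · intro b _ hb
      simp [Ne.symm hb]
    · simp
  simp_rw [h3]
  rw [Finset.sum_mul_sum, Finset.mul_sum]
  exact Finset.sum_congr rfl fun j _ => (Finset.mul_sum _ _ _).symm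

/-- Telescoping over the cells of the interval `(k, k+1]`. -/
theorem sum_blockStep_sub {N m : ℕ} (hm : m ≠ 0) (c : ℕ → ℝ) (g : ℝ≥0 → ℝ) (k : Fin N) :
    ∑ j : Fin m, (g ((blockStep N m c).t (finProdFinEquiv (k, j)).succ) -
      g ((blockStep N m c).t (finProdFinEquiv (k, j)).castSucc)) = g (k + 1) - g k := by
  have h : ∀ j : Fin m, g ((blockStep N m c).t (finProdFinEquiv (k, j)).succ) -
      g ((blockStep N m c).t (finProdFinEquiv (k, j)).castSucc) =
      (fun j : ℕ => g (((j + m * k : ℕ) : ℝ≥0) / m)) (j + 1) -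
        (fun j : ℕ => g (((j + m * k : ℕ) : ℝ≥0) / m)) j := by
    intro j
    change g (((finProdFinEquiv (k, j)).succ : ℕ) / m) -
      g (((finProdFinEquiv (k, j)).castSucc : ℕ) / m) = _
    simp only [Fin.val_succ, Fin.val_castSucc, finProdFinEquiv_apply_val]
    rw [show (j : ℕ) + m * k + 1 = j + 1 + m * k by ring]
  have hm' : (m : ℝ≥0) ≠ 0 := by exact_mod_cast hm
  simp_rw [h]
  rw [Fin.sum_univ_eq_sum_range (fun j => (fun j : ℕ => g (((j + m * k : ℕ) : ℝ≥0) / m)) (j + 1) -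
        (fun j : ℕ => g (((j + m * k : ℕ) : ℝ≥0) / m)) j),
    Finset.sum_range_sub fun j : ℕ => g (((j + m * k : ℕ) : ℝ≥0) / m)]
  congr 2
  · push_cast; field_simp; ring
  · push_cast; field_simp; ring

theorem indicator_Ioc_eq_sub {a b : ℝ≥0} (hab : a ≤ b) (x : ℝ≥0) :
    (Set.Ioc a b).indicator (1 : ℝ≥0 → ℝ) x =
      (if x ≤ b then 1 else 0) - if x ≤ a then 1 else 0 := by
  by_cases h1 : x ≤ a
  · simp [h1, h1.trans hab]
  · by_cases h2 : x ≤ b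
    · simp [h1, h2, not_le.1 h1]
    · simp [h1, h2]

theorem sum_blockStep_indicator {N m : ℕ} (hm : m ≠ 0) (c : ℕ → ℝ) (x : ℝ≥0) (k : Fin N) :
    ∑ j : Fin m, ((blockStep N m c).cell (finProdFinEquiv (k, j))).indicator (1 : ℝ≥0 → ℝ) x =
      (Set.Ioc (k : ℝ≥0) (k + 1)).indicator 1 x := by
  rw [indicator_Ioc_eq_sub (by simp),
    ← sum_blockStep_sub hm c (fun u => if x ≤ u then 1 else 0) k]
  exact Finset.sum_congr rfl fun j _ => indicator_Ioc_eq_sub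
    ((blockStep N m c).mono (Fin.castSucc_le_succ _)) x

theorem blockStep_toFun {N m : ℕ} (hm : m ≠ 0) (c : ℕ → ℝ) (p : ℝ≥0 × ℝ≥0) :
    (blockStep N m c).toFun p = ∑ k ∈ Finset.range N, c k * unitSquare k p -
      ∑ i : Fin (N * m), c (finProdFinEquiv.symm i).1 *
        (((blockStep N m c).cell i).indicator 1 p.1 *
          ((blockStep N m c).cell i).indicator 1 p.2) := by
  refine (sum_blockStep_coeff_mul c
    (fun i => ((blockStep N m c).cell i).indicator (1 : ℝ≥0 → ℝ) p.1)
    (fun i => ((blockStep N m c).cell i).indicator (1 : ℝ≥0 → ℝ) p.2)).trans ?_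
  simp_rw [sum_blockStep_indicator hm]
  rw [Finset.sum_range]
  rfl

theorem blockStep_integral {Ω : Type*} {N m : ℕ} (hm : m ≠ 0) (c : ℕ → ℝ) (W : ℝ≥0 → Ω → ℝ)
    (ω : Ω) :
    (blockStep N m c).integral W ω =
      ∑ k ∈ Finset.range N, c k * (W (k + 1) ω - W k ω) ^ 2 -
      ∑ i : Fin (N * m), c (finProdFinEquiv.symm i).1 *
        (W ((blockStep N m c).t i.succ) ω - W ((blockStep N m c).t i.castSucc) ω) ^ 2 := by
  refine (sum_blockStep_coeff_mul c
    (fun i => W ((blockStep N m c).t i.succ) ω - W ((blockStep N m c).t i.castSucc) ω)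
    (fun i => W ((blockStep N m c).t i.succ) ω - W ((blockStep N m c).t i.castSucc) ω)).trans ?_
  simp_rw [sum_blockStep_sub hm c (fun u => W u ω)]
  rw [Finset.sum_range]
  simp_rw [sq]

theorem blockStep_succ_sub {N m : ℕ} (c : ℕ → ℝ) (i : Fin (N * m)) :
    (blockStep N m c).t i.succ - (blockStep N m c).t i.castSucc = 1 / m := by
  change ((i.succ : ℕ) : ℝ≥0) / m - ((i.castSucc : ℕ) : ℝ≥0) / m = 1 / m
  rw [← tsub_div]
  simp

/-! ### Convergence of the kernels -/

theorem memLp_indicator_mul_indicator {a b : ℝ≥0} :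
    MemLp (fun p : ℝ≥0 × ℝ≥0 => (Set.Ioc a b).indicator (1 : ℝ≥0 → ℝ) p.1 *
      (Set.Ioc a b).indicator (1 : ℝ≥0 → ℝ) p.2) 2 (lebesgueNNReal.prod lebesgueNNReal) := by
  have e : (fun p : ℝ≥0 × ℝ≥0 => (Set.Ioc a b).indicator (1 : ℝ≥0 → ℝ) p.1 *
      (Set.Ioc a b).indicator (1 : ℝ≥0 → ℝ) p.2) =
      (Set.Ioc a b ×ˢ Set.Ioc a b).indicator fun _ => (1 : ℝ) := by
    ext p
    by_cases h1 : p.1 ∈ Set.Ioc a b <;> by_cases h2 : p.2 ∈ Set.Ioc a b <;>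
      simp [Set.indicator, Set.mem_prod, h1, h2]
  rw [e]
  refine memLp_indicator_const 2 (measurableSet_Ioc.prod measurableSet_Ioc) 1 (Or.inr ?_)
  rw [Measure.prod_prod, lebesgueNNReal_Ioc]
  finiteness

theorem integral_indicator_Ioc (a b : ℝ≥0) (hab : a ≤ b) :
    ∫ x, (Set.Ioc a b).indicator (1 : ℝ≥0 → ℝ) x ∂lebesgueNNReal = b - a := by
  rw [integral_indicator_one measurableSet_Ioc, measureReal_def, lebesgueNNReal_Ioc,
    ENNReal.toReal_ofReal]
  simpa using hab

theorem memLp_unitSquare (k : ℕ) :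
    MemLp (unitSquare k) 2 (lebesgueNNReal.prod lebesgueNNReal) :=
  memLp_indicator_mul_indicator

theorem integral_unitSquare_mul (j k : ℕ) :
    ∫ p, unitSquare j p * unitSquare k p ∂(lebesgueNNReal.prod lebesgueNNReal) =
      if j = k then 1 else 0 := by
  set I : ℕ → ℝ≥0 → ℝ := fun j => (Set.Ioc (j : ℝ≥0) (j + 1)).indicator 1 with hI
  have h1 : ∀ p : ℝ≥0 × ℝ≥0, unitSquare j p * unitSquare k p =
      (I j p.1 * I k p.1) * (I j p.2 * I k p.2) := fun p => by
    simp only [unitSquare, hI]; ring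
  have h2 : ∫ x, I j x * I k x ∂lebesgueNNReal = if j = k then 1 else 0 := by
    by_cases hjk : j = k
    · subst hjk
      have : ∀ x, I j x * I j x = (Set.Ioc (j : ℝ≥0) (j + 1)).indicator 1 x := fun x => by
        by_cases h : x ∈ Set.Ioc (j : ℝ≥0) (j + 1) <;> simp [hI, Set.indicator, h]
      simp_rw [this]
      rw [integral_indicator_Ioc _ _ (by simp)]
      simp
    · have : ∀ x, I j x * I k x = 0 := fun x => by
        by_contra h
        simp only [hI, mul_eq_zero, not_or, Set.indicator_apply_ne_zero] at h
        obtain ⟨⟨⟨h1, h2⟩, -⟩, ⟨⟨h3, h4⟩, -⟩⟩ := h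
        have h5 : (j : ℝ≥0) < ((k + 1 : ℕ) : ℝ≥0) := by push_cast; exact h1.trans_le h4
        have h6 : (k : ℝ≥0) < ((j + 1 : ℕ) : ℝ≥0) := by push_cast; exact h3.trans_le h2
        have h7 : j < k + 1 := by exact_mod_cast h5
        have h8 : k < j + 1 := by exact_mod_cast h6
        omega
      simp [this, hjk]
  simp_rw [h1]
  rw [integral_prod_mul (fun x => I j x * I k x) (fun x => I j x * I k x), h2]
  split_ifs <;> simp

/-- The kernels of the block steps converge to the full diagonal squares as the mesh `1 / m` tends
to zero: the missing diagonal cells have total area at most `N / m`. -/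
theorem tendsto_eLpNorm_blockStep_toFun (N : ℕ) (c : ℕ → ℝ) :
    Tendsto (fun m : ℕ => eLpNorm (fun p => (blockStep N (m + 1) c).toFun p -
      ∑ k ∈ Finset.range N, c k * unitSquare k p) 2 (lebesgueNNReal.prod lebesgueNNReal)) atTop
      (𝓝 0) := by
  set C := ∑ k ∈ Finset.range N, |c k| with hC
  set d : (m : ℕ) → Fin (N * (m + 1)) → ℝ≥0 × ℝ≥0 → ℝ := fun m i p =>
    ((blockStep N (m + 1) c).cell i).indicator 1 p.1 *
      ((blockStep N (m + 1) c).cell i).indicator 1 p.2 with hd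
  have hind : ∀ (A : Set ℝ≥0) x, 0 ≤ A.indicator (1 : ℝ≥0 → ℝ) x ∧ A.indicator 1 x ≤ (1 : ℝ) :=
    fun A x => by by_cases h : x ∈ A <;> simp [h]
  have hd0 : ∀ m i p, 0 ≤ d m i p := fun m i p => mul_nonneg (hind _ _).1 (hind _ _).1
  have hdmem : ∀ m i, MemLp (d m i) 2 (lebesgueNNReal.prod lebesgueNNReal) := fun m i =>
    memLp_indicator_mul_indicator
  have e : ∀ m p, (blockStep N (m + 1) c).toFun p - ∑ k ∈ Finset.range N, c k * unitSquare k p =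
      -∑ i, c (finProdFinEquiv.symm i).1 * d m i p := fun m p => by
    rw [blockStep_toFun (Nat.succ_ne_zero m)]; ring
  simp_rw [e]
  have hmem : ∀ m, MemLp (fun p => -∑ i, c (finProdFinEquiv.symm i).1 * d m i p) 2
      (lebesgueNNReal.prod lebesgueNNReal) := fun m =>
    (memLp_finsetSum _ fun i _ => (hdmem m i).const_mul _).neg
  refine tendsto_eLpNorm_two_of_integral_sq hmem ?_
  have hint : ∀ m i, Integrable (d m i) (lebesgueNNReal.prod lebesgueNNReal) ∧
      ∫ p, d m i p ∂(lebesgueNNReal.prod lebesgueNNReal) = (1 / (m + 1)) ^ 2 := by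
    intro m i
    have hval := integral_indicator_Ioc _ _ ((blockStep N (m + 1) c).mono
      (Fin.castSucc_le_succ i))
    have hsub := blockStep_succ_sub c i
    have hsub' : ((blockStep N (m + 1) c).t i.succ : ℝ) - (blockStep N (m + 1) c).t i.castSucc =
        1 / (m + 1) := by
      rw [← NNReal.coe_sub ((blockStep N (m + 1) c).mono (Fin.castSucc_le_succ i)), hsub]
      push_cast; ring
    rw [hsub'] at hval
    have hi : Integrable (((blockStep N (m + 1) c).cell i).indicator (1 : ℝ≥0 → ℝ))
        lebesgueNNReal := .of_integral_ne_zero (by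
          refine ne_of_eq_of_ne hval ?_
          positivity)
    refine ⟨hi.mul_prod hi, ?_⟩
    rw [hd, integral_prod_mul (((blockStep N (m + 1) c).cell i).indicator (1 : ℝ≥0 → ℝ))
      (((blockStep N (m + 1) c).cell i).indicator (1 : ℝ≥0 → ℝ)), sq]
    congr 1
  -- The squared error is at most `C² * ∑ d ≤ C² * N / (m + 1)`.
  have hbound : ∀ m p, (-∑ i, c (finProdFinEquiv.symm i).1 * d m i p) ^ 2 ≤
      C ^ 2 * ∑ i, d m i p := by
    intro m p
    have hc : ∀ i : Fin (N * (m + 1)), |c (finProdFinEquiv.symm i).1| ≤ C := fun i =>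
      Finset.single_le_sum (f := fun k => |c k|) (fun _ _ => abs_nonneg _)
        (Finset.mem_range.2 (finProdFinEquiv.symm i).1.2)
    have h1 : |∑ i, c (finProdFinEquiv.symm i).1 * d m i p| ≤ C * ∑ i, d m i p := by
      rw [Finset.mul_sum]
      refine (Finset.abs_sum_le_sum_abs _ _).trans (Finset.sum_le_sum fun i _ => ?_)
      rw [abs_mul, abs_of_nonneg (hd0 m i p)]
      exact mul_le_mul_of_nonneg_right (hc i) (hd0 m i p)
    have h0 : 0 ≤ ∑ i, d m i p := Finset.sum_nonneg fun i _ => hd0 m i p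
    have h2 : ∑ i, d m i p ≤ 1 := by
      calc ∑ i, d m i p ≤ ∑ i : Fin (N * (m + 1)),
            ((blockStep N (m + 1) c).cell i).indicator (1 : ℝ≥0 → ℝ) p.1 :=
          Finset.sum_le_sum fun i _ => mul_le_of_le_one_right (hind _ _).1 (hind _ _).2
        _ = ∑ k : Fin N, (Set.Ioc (k : ℝ≥0) (k + 1)).indicator (1 : ℝ≥0 → ℝ) p.1 := by
          rw [← Equiv.sum_comp finProdFinEquiv, Fintype.sum_prod_type]
          exact Finset.sum_congr rfl fun k _ => sum_blockStep_indicator (Nat.succ_ne_zero m) c p.1 k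
        _ = (if p.1 ≤ N then 1 else 0) - if p.1 ≤ 0 then 1 else 0 := by
          rw [Finset.sum_congr rfl fun k _ => indicator_Ioc_eq_sub (by simp) p.1]
          have := Finset.sum_range_sub (fun k : ℕ => if p.1 ≤ (k : ℝ≥0) then (1 : ℝ) else 0) N
          rw [Finset.sum_range] at this
          push_cast at this
          exact this
        _ ≤ 1 := by split_ifs <;> norm_num
    rw [neg_sq, ← sq_abs]
    calc _ ≤ (C * ∑ i, d m i p) ^ 2 := by gcongr
      _ = C ^ 2 * ((∑ i, d m i p) * ∑ i, d m i p) := by ring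
      _ ≤ _ := by
        gcongr
        exact mul_le_of_le_one_right h0 h2
  refine squeeze_zero (g := fun m : ℕ => C ^ 2 * N * (1 / ((m : ℝ) + 1)))
    (fun m => integral_nonneg fun p => sq_nonneg _) (fun m => ?_) ?_
  · calc _ ≤ ∫ p, C ^ 2 * ∑ i, d m i p ∂(lebesgueNNReal.prod lebesgueNNReal) :=
        integral_mono (hmem m).integrable_sq
          ((integrable_finsetSum _ fun i _ => (hint m i).1).const_mul _) (hbound m)
      _ = _ := by
        rw [integral_const_mul, integral_finsetSum _ fun i _ => (hint m i).1]
        simp_rw [(hint m _).2]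
        simp
        field_simp
  · simpa using (tendsto_one_div_add_atTop_nhds_zero_nat (𝕜 := ℝ)).const_mul (C ^ 2 * N)

/-! ### Convergence of the random variables -/

section Increments

variable {Ω : Type*} [MeasurableSpace Ω] {P : Measure Ω} {W : ℝ≥0 → Ω → ℝ}

theorem memLp_hermiteTwo_comp {ξ : Ω → ℝ} (hξ : HasLaw ξ (gaussianReal 0 1) P) :
    MemLp (fun ω => hermiteTwo (ξ ω)) 2 P := by
  have := memLp_hermiteTwo
  rw [← hξ.map_eq] at this
  exact this.comp_of_map hξ.aemeasurable

theorem integral_hermiteTwo_mul {ι : Type*} [DecidableEq ι] {ξ : ι → Ω → ℝ}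
    (hξ : ∀ i, HasLaw (ξ i) (gaussianReal 0 1) P) (hind : iIndepFun ξ P) (j k : ι) :
    ∫ ω, hermiteTwo (ξ j ω) * hermiteTwo (ξ k ω) ∂P = if j = k then 1 else 0 := by
  have h0 : ∀ j, ∫ ω, hermiteTwo (ξ j ω) ∂P = 0 := fun j =>
    ((hξ j).integral_comp (by fun_prop)).trans integral_hermiteTwo
  split_ifs with h
  · subst h
    refine Eq.trans ?_ integral_hermiteTwo_sq
    simp_rw [← sq]
    exact (hξ j).integral_comp (f := fun x => hermiteTwo x ^ 2) (by fun_prop)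
  · have hi : IndepFun (fun ω => hermiteTwo (ξ j ω)) (fun ω => hermiteTwo (ξ k ω)) P :=
      (hind.indepFun h).comp measurable_hermiteTwo measurable_hermiteTwo
    rw [hi.integral_fun_mul_eq_mul_integral
      (memLp_hermiteTwo_comp (hξ j)).aestronglyMeasurable
      (memLp_hermiteTwo_comp (hξ k)).aestronglyMeasurable, h0, zero_mul]

theorem hasLaw_unit_increment (hW : IsPreBrownianReal W P) (k : ℕ) :
    HasLaw (fun ω => W (k + 1) ω - W k ω) (gaussianReal 0 1) P := by
  simpa using hasLaw_increment hW (a := k) (b := k + 1) (by simp)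

theorem iIndepFun_unit_increment (hW : IsPreBrownianReal W P) :
    iIndepFun (fun (k : ℕ) ω => W (k + 1) ω - W k ω) P := by
  have := hW.hasIndepIncrements.nat (t := fun k : ℕ => (k : ℝ≥0)) Nat.mono_cast
  simpa using this

/-- The error is a linear combination of variables `ξ² - 1`, for independent standard Gaussian
variables `ξ` indexed by the `N m` cells, with coefficients of order `1 / m`; its second moment is
therefore of order `1 / m`. -/
theorem tendsto_eLpNorm_blockStep_integral (hW : IsPreBrownianReal W P) (N : ℕ) (c : ℕ → ℝ) :
    Tendsto (fun m : ℕ => eLpNorm (fun ω => (blockStep N (m + 1) c).integral W ω -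
      ∑ k ∈ Finset.range N, c k * √2 * hermiteTwo (W (k + 1) ω - W k ω)) 2 P) atTop (𝓝 0) := by
  -- The increments over the cells, rescaled to be standard Gaussian.
  set ξ : (m : ℕ) → Fin (N * (m + 1)) → Ω → ℝ := fun m i ω => √(m + 1) *
    (W ((blockStep N (m + 1) c).t i.succ) ω - W ((blockStep N (m + 1) c).t i.castSucc) ω) with hξdef
  have hξ : ∀ m i, HasLaw (ξ m i) (gaussianReal 0 1) P := by
    intro m i
    have h1 := gaussianReal_const_mul (hasLaw_increment hW
      ((blockStep N (m + 1) c).mono (Fin.castSucc_le_succ i))) (√(m + 1))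
    convert h1 using 2
    · simp
    · rw [blockStep_succ_sub]
      ext
      push_cast
      rw [Real.sq_sqrt (by positivity)]
      field_simp
  have hind : ∀ m, iIndepFun (ξ m) P := fun m =>
    (hW.hasIndepIncrements _ _ (blockStep N (m + 1) c).mono).comp (fun _ x => √(m + 1) * x)
      fun _ => by fun_prop
  have e : ∀ m ω, (blockStep N (m + 1) c).integral W ω -
      ∑ k ∈ Finset.range N, c k * √2 * hermiteTwo (W (k + 1) ω - W k ω) =
      ∑ i, (-(c (finProdFinEquiv.symm i).1 * √2 / (m + 1))) * hermiteTwo (ξ m i ω) := by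
    intro m ω
    have hm : (0 : ℝ) < m + 1 := by positivity
    have h2 : √(2 : ℝ) ≠ 0 := by positivity
    have h1 : ∀ k : ℕ, c k * √2 * hermiteTwo (W (k + 1) ω - W k ω) =
        c k * (W (k + 1) ω - W k ω) ^ 2 - c k := by
      intro k
      rw [hermiteTwo]; field_simp
    have h3 : ∀ i : Fin (N * (m + 1)),
        (-(c (finProdFinEquiv.symm i).1 * √2 / (m + 1))) * hermiteTwo (ξ m i ω) =
        c (finProdFinEquiv.symm i).1 / (m + 1) - c (finProdFinEquiv.symm i).1 *
        (W ((blockStep N (m + 1) c).t i.succ) ω -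
          W ((blockStep N (m + 1) c).t i.castSucc) ω) ^ 2 := by
      intro i
      rw [hermiteTwo, hξdef]
      simp only
      rw [mul_pow, Real.sq_sqrt hm.le]
      field_simp
      ring
    have h4 : ∑ i : Fin (N * (m + 1)), c (finProdFinEquiv.symm i).1 / ((m : ℝ) + 1) =
        ∑ k ∈ Finset.range N, c k := by
      rw [← Equiv.sum_comp finProdFinEquiv, Fintype.sum_prod_type, Finset.sum_range]
      refine Finset.sum_congr rfl fun k _ => ?_
      simp only [Equiv.symm_apply_apply, Finset.sum_const, Finset.card_univ, Fintype.card_fin,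
        nsmul_eq_mul]
      push_cast
      field_simp
    rw [blockStep_integral (Nat.succ_ne_zero m)]
    simp_rw [h1, h3]
    rw [Finset.sum_sub_distrib, Finset.sum_sub_distrib, h4]
    ring
  simp_rw [e]
  refine tendsto_eLpNorm_two_of_integral_sq
    (fun m => memLp_finsetSum _ fun i _ => (memLp_hermiteTwo_comp (hξ m i)).const_mul _) ?_
  have hsq : ∀ m : ℕ, ∫ ω, (∑ i, (-(c (finProdFinEquiv.symm i).1 * √2 / (m + 1))) *
      hermiteTwo (ξ m i ω)) ^ 2 ∂P =
      (2 * ∑ k ∈ Finset.range N, c k ^ 2) * (1 / ((m : ℝ) + 1)) := by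
    intro m
    rw [integral_sq_sum_of_orthonormal (fun i => memLp_hermiteTwo_comp (hξ m i))
      (integral_hermiteTwo_mul (hξ m) (hind m)), ← Equiv.sum_comp finProdFinEquiv,
      Fintype.sum_prod_type, Finset.sum_range, Finset.mul_sum, Finset.sum_mul]
    refine Finset.sum_congr rfl fun k _ => ?_
    simp only [Equiv.symm_apply_apply, Finset.sum_const, Finset.card_univ, Fintype.card_fin,
      nsmul_eq_mul]
    rw [neg_sq, div_pow, mul_pow, Real.sq_sqrt (by norm_num)]
    push_cast
    field_simp
  simp_rw [hsq]
  simpa using (tendsto_one_div_add_atTop_nhds_zero_nat (𝕜 := ℝ)).const_mul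
    (2 * ∑ k ∈ Finset.range N, c k ^ 2)

/-- The factor `√2` makes `hermiteTwo` of variance one, whereas the double integral of the indicator
of `(k, k+1]²` is `(W (k + 1) - W k)² - 1`. -/
theorem isDoubleWienerIntegral_sum_unitSquare (hW : IsPreBrownianReal W P) (N : ℕ) (c : ℕ → ℝ) :
    IsDoubleWienerIntegral W P (fun p => ∑ k ∈ Finset.range N, c k / √2 * unitSquare k p)
      (fun ω => ∑ k ∈ Finset.range N, c k * hermiteTwo (W (k + 1) ω - W k ω)) where
  isSymmL2 := ⟨memLp_finsetSum _ fun k _ => (memLp_unitSquare k).const_mul _,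
    ae_of_all _ fun p => by simp [unitSquare, mul_comm]⟩
  memLp := memLp_finsetSum _ fun k _ =>
    (memLp_hermiteTwo_comp (hasLaw_unit_increment hW k)).const_mul _
  exists_approx := by
    refine ⟨fun m => blockStep N (m + 1) fun k => c k / √2,
      tendsto_eLpNorm_blockStep_toFun N _, ?_⟩
    have := tendsto_eLpNorm_blockStep_integral hW N fun k => c k / √2
    simpa using this

/-- For square-summable coefficients `c`, the variable `∑ c k * (ξ k ² - 1) / √2` built from the
increments `ξ k = W (k + 1) - W k` is a double integral. -/
theorem exists_isDoubleWienerIntegral_of_summable_sq (hW : IsPreBrownianReal W P) {c : ℕ → ℝ}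
    (hc : Summable fun k => c k ^ 2) :
    ∃ f G, IsDoubleWienerIntegral W P f G ∧ Tendsto (fun N => eLpNorm (fun ω =>
      ∑ k ∈ Finset.range N, c k * hermiteTwo (W (k + 1) ω - W k ω) - G ω) 2 P) atTop (𝓝 0) := by
  obtain ⟨f, hf, hflim⟩ := exists_tendsto_eLpNorm_sum_of_orthonormal (c := fun k => c k / √2)
    memLp_unitSquare integral_unitSquare_mul (by simpa [div_pow] using hc.div_const 2)
  obtain ⟨G, hG, hGlim⟩ := exists_tendsto_eLpNorm_sum_of_orthonormal (μ := P)
    (fun k => memLp_hermiteTwo_comp (hasLaw_unit_increment hW k))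
    (integral_hermiteTwo_mul (hasLaw_unit_increment hW) (iIndepFun_unit_increment hW)) hc
  exact ⟨f, G, .of_tendsto hW.aemeasurable
    (fun N => isDoubleWienerIntegral_sum_unitSquare hW N c) hf hG hflim hGlim, hGlim⟩

end Increments

/-! ### Limit laws of double integrals -/

section Limits

variable {Ω : Type u} [MeasurableSpace Ω] {P : Measure Ω} [IsProbabilityMeasure P]

theorem tendstoInDistribution_iff_tendsto_charFun {Ω₁ : Type v} [MeasurableSpace Ω₁]
    {P₁ : Measure Ω₁} [IsProbabilityMeasure P₁] {F : ℕ → Ω → ℝ} {Z : Ω₁ → ℝ}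
    (hF : ∀ n, AEMeasurable (F n) P) (hZ : AEMeasurable Z P₁) :
    TendstoInDistribution F atTop Z (fun _ => P) P₁ ↔
      ∀ t, Tendsto (fun n => charFun (P.map (F n)) t) atTop (𝓝 (charFun (P₁.map Z) t)) :=
  ⟨fun h => ProbabilityMeasure.tendsto_iff_tendsto_charFun.1 h.tendsto,
    fun h => ⟨hF, hZ, ProbabilityMeasure.tendsto_iff_tendsto_charFun.2 h⟩⟩

theorem tendsto_charFun_of_tendsto_eLpNorm {F : ℕ → Ω → ℝ} {Z : Ω → ℝ}
    (hF : ∀ n, AEMeasurable (F n) P) (hZ : AEMeasurable Z P)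
    (h : Tendsto (fun n => eLpNorm (fun ω => F n ω - Z ω) 2 P) atTop (𝓝 0)) (t : ℝ) :
    Tendsto (fun n => charFun (P.map (F n)) t) atTop (𝓝 (charFun (P.map Z) t)) :=
  (tendstoInDistribution_iff_tendsto_charFun hF hZ).1
    ((tendstoInMeasure_of_tendsto_eLpNorm (by simp) (fun n => (hF n).aestronglyMeasurable)
      hZ.aestronglyMeasurable h).tendstoInDistribution hF) t

variable {W : ℝ≥0 → Ω → ℝ}

/-- The elementary integrals approximating `G` are measurable functions of `W`, hence independent of
`N`; so the characteristic functions of `N` and `G` multiply in the limit. -/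
theorem IsDoubleWienerIntegral.charFun_add_gaussian (hW : ∀ t, AEMeasurable (W t) P)
    {f : ℝ≥0 × ℝ≥0 → ℝ} {G : Ω → ℝ} (hG : IsDoubleWienerIntegral W P f G)
    {Ω' : Type u} [MeasurableSpace Ω'] {P' : Measure Ω'} {π : Ω' → Ω} {N : Ω' → ℝ} {v : ℝ≥0}
    (hπ : MeasurePreserving π P' P) (hN : HasLaw N (gaussianReal 0 v) P')
    (hind : IndepFun N (fun ω' t => W t (π ω')) P') (t : ℝ) :
    charFun (P'.map fun ω' => N ω' + G (π ω')) t =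
      Complex.exp (-(t ^ 2 * v / 2 : ℝ)) * charFun (P.map G) t := by
  have : IsProbabilityMeasure P' := hN.isProbabilityMeasure
  obtain ⟨s, -, hs⟩ := hG.exists_approx
  have hm : ∀ k, AEMeasurable ((s k).integral W) P := fun k => (s k).aemeasurable_integral hW
  have hmπ : ∀ {H : Ω → ℝ}, AEMeasurable H P → AEMeasurable (fun ω' => H (π ω')) P' :=
    fun hH => hH.comp_quasiMeasurePreserving hπ.quasiMeasurePreserving
  have hGm : AEMeasurable G P := hG.memLp.aestronglyMeasurable.aemeasurable
  have hlim := tendsto_charFun_of_tendsto_eLpNorm (P := P')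
    (F := fun k ω' => N ω' + (s k).integral W (π ω')) (Z := fun ω' => N ω' + G (π ω'))
    (fun k => hN.aemeasurable.add (hmπ (hm k))) (hN.aemeasurable.add (hmπ hGm))
    (by
      refine hs.congr fun k => ?_
      refine (eLpNorm_comp_measurePreserving
        ((hm k).aestronglyMeasurable.sub hGm.aestronglyMeasurable) hπ).symm.trans ?_
      congr 1
      ext ω'
      simp) t
  refine tendsto_nhds_unique hlim ?_
  have hprod : ∀ k, charFun (P'.map fun ω' => N ω' + (s k).integral W (π ω')) t =
      Complex.exp (-(t ^ 2 * v / 2 : ℝ)) * charFun (P.map ((s k).integral W)) t := by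
    intro k
    set q : (ℝ≥0 → ℝ) → ℝ := fun w => (s k).integral (fun u (_ : Unit) => w u) () with hq
    have hqm : Measurable q := by
      simp only [hq, OffDiagStep.integral]
      fun_prop
    have hi : IndepFun N (fun ω' => (s k).integral W (π ω')) P' :=
      hind.comp measurable_id hqm
    rw [hi.charFun_map_fun_add_eq_mul hN.aemeasurable (hmπ (hm k)), Pi.mul_apply, hN.map_eq,
      charFun_gaussianReal, ← hπ.map_eq, AEMeasurable.map_map_of_aemeasurable
        (by rw [hπ.map_eq]; exact hm k) hπ.aemeasurable]
    congr 2
    push_cast; ring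
  simp_rw [hprod]
  exact (tendsto_charFun_of_tendsto_eLpNorm hm hGm hs t).const_mul _

/-- A limit in law of double integrals has the characteristic function of the sum of a double
integral and an independent centred Gaussian variable. -/
theorem exists_charFun_eq_of_tendstoInDistribution (hW : IsPreBrownianReal W P)
    {Ω₁ : Type v} [MeasurableSpace Ω₁] {P₁ : Measure Ω₁} [IsProbabilityMeasure P₁] {Z : Ω₁ → ℝ}
    {F : ℕ → Ω → ℝ} (hF : ∀ n, ∃ f, IsDoubleWienerIntegral W P f (F n))
    (hlim : TendstoInDistribution F atTop Z (fun _ => P) P₁) :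
    ∃ (σ : ℝ) (f : ℝ≥0 × ℝ≥0 → ℝ) (G : Ω → ℝ), IsDoubleWienerIntegral W P f G ∧ ∀ t,
      charFun (P₁.map Z) t = Complex.exp (-(t ^ 2 * σ ^ 2 / 2 : ℝ)) * charFun (P.map G) t := by
  -- Elementary integrals with the same limit in law.
  have hs : ∀ n : ℕ, ∃ s : OffDiagStep,
      eLpNorm (fun ω => s.integral W ω - F n ω) 2 P ≤ ((n : ℝ≥0∞) + 1)⁻¹ := by
    intro n
    obtain ⟨f, hf⟩ := hF n
    obtain ⟨s, -, h2⟩ := hf.exists_approx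
    have hpos : (0 : ℝ≥0∞) < ((n : ℝ≥0∞) + 1)⁻¹ := by simp
    obtain ⟨k, hk⟩ := (h2.eventually_le_const hpos).exists
    exact ⟨s k, hk⟩
  choose s hs using hs
  have hm : ∀ n, AEMeasurable ((s n).integral W) P := fun n =>
    (s n).aemeasurable_integral hW.aemeasurable
  have hlim0 : Tendsto (fun n => eLpNorm ((fun ω => (s n).integral W ω) - F n) 2 P) atTop
      (𝓝 0) := by
    have := ENNReal.tendsto_inv_nat_nhds_zero.comp (tendsto_add_atTop_nat 1)
    exact tendsto_of_tendsto_of_tendsto_of_le_of_le tendsto_const_nhds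
      (by simpa [Function.comp_def] using this) (fun _ => zero_le) hs
  have hE : TendstoInDistribution (fun n => (s n).integral W) atTop Z (fun _ => P) P₁ := by
    refine tendstoInDistribution_of_tendstoInMeasure_sub _ Z hlim ?_ hm
    exact tendstoInMeasure_of_tendsto_eLpNorm (p := 2) (by simp)
      (fun n => ((hm n).sub (hlim.forall_aemeasurable n)).aestronglyMeasurable)
      aestronglyMeasurable_zero (by simpa using! hlim0)
  have hchar := (tendstoInDistribution_iff_tendsto_charFun hm hlim.aemeasurable_limit).1 hE
  choose c hc using fun n => (s n).exists_charFun_integral_eq_prod hW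
  choose a ha0 hanti ha using fun n => exists_antitone_rearrangement (c n)
  have : IsProbabilityMeasure (P₁.map Z) :=
    Measure.isProbabilityMeasure_map hlim.aemeasurable_limit
  obtain ⟨b, σ, hb, hbφ⟩ := exists_sq_summable_of_tendsto_prod_hermiteTwoCharFun ha0 hanti
    (φ := charFun (P₁.map Z))
    (fun t => (hchar t).congr fun n => by
      rw [hc, ← ha n fun x => hermiteTwoCharFun (t * x)])
    (by fun_prop)
  obtain ⟨f, G, hG, hGlim⟩ := exists_isDoubleWienerIntegral_of_summable_sq hW hb
  refine ⟨σ, f, G, hG, fun t => ?_⟩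
  have hpart : ∀ K : ℕ, AEMeasurable (fun ω => ∑ k ∈ Finset.range K,
      b k * hermiteTwo (W (k + 1) ω - W k ω)) P := fun K =>
    (isDoubleWienerIntegral_sum_unitSquare hW K b).memLp.aestronglyMeasurable.aemeasurable
  have h1 := tendsto_charFun_of_tendsto_eLpNorm hpart
    hG.memLp.aestronglyMeasurable.aemeasurable hGlim t
  simp_rw [charFun_map_sum_hermiteTwo (hasLaw_unit_increment hW) (iIndepFun_unit_increment hW)]
    at h1
  rw [mul_comm]
  exact tendsto_nhds_unique (hbφ t) (h1.mul_const _)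

/-- Conversely, the Gaussian factor is produced by the central limit theorem, from `n` additional
eigenvalues equal to `σ / √n`. -/
theorem IsDoubleWienerIntegral.exists_tendstoInDistribution_of_charFun_eq
    (hW : IsPreBrownianReal W P) {f : ℝ≥0 × ℝ≥0 → ℝ} {G : Ω → ℝ}
    (hG : IsDoubleWienerIntegral W P f G) {σ : ℝ}
    {Ω₁ : Type v} [MeasurableSpace Ω₁] {P₁ : Measure Ω₁} [IsProbabilityMeasure P₁] {Z : Ω₁ → ℝ}
    (hZ : AEMeasurable Z P₁) (hchar : ∀ t,
      charFun (P₁.map Z) t = Complex.exp (-(t ^ 2 * σ ^ 2 / 2 : ℝ)) * charFun (P.map G) t) :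
    ∃ F : ℕ → Ω → ℝ, (∀ n, ∃ f, IsDoubleWienerIntegral W P f (F n)) ∧
      TendstoInDistribution F atTop Z (fun _ => P) P₁ := by
  obtain ⟨s, -, hs⟩ := hG.exists_approx
  choose c hc using fun n => (s n).exists_charFun_integral_eq_prod hW
  choose a ha0 hanti ha using fun n => exists_antitone_rearrangement (c n)
  set d : ℕ → ℕ → ℝ := fun n k => if k < (s n).m then a n k else (√n)⁻¹ * σ with hd
  have hDWI := fun n => isDoubleWienerIntegral_sum_unitSquare hW ((s n).m + n) (d n)
  refine ⟨_, fun n => ⟨_, hDWI n⟩, (tendstoInDistribution_iff_tendsto_charFun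
    (fun n => (hDWI n).memLp.aestronglyMeasurable.aemeasurable) hZ).2 fun t => ?_⟩
  simp_rw [charFun_map_sum_hermiteTwo (hasLaw_unit_increment hW) (iIndepFun_unit_increment hW)]
  have hsplit : ∀ n, ∏ k ∈ Finset.range ((s n).m + n), hermiteTwoCharFun (t * d n k) =
      hermiteTwoCharFun ((√n)⁻¹ * (t * σ)) ^ n * charFun (P.map ((s n).integral W)) t := by
    intro n
    rw [Finset.prod_range_add, hc, ← ha n fun x => hermiteTwoCharFun (t * x), mul_comm]
    congr 1
    · rw [Finset.prod_congr rfl (g := fun _ => hermiteTwoCharFun ((√n)⁻¹ * (t * σ)))]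
      · simp
      · intro k _
        simp only [hd, Nat.not_lt.2 (Nat.le_add_right _ k), if_false]
        congr 1; ring
    · refine Finset.prod_congr rfl fun k hk => ?_
      simp only [hd, Finset.mem_range.1 hk, if_true]
  simp_rw [hsplit]
  rw [hchar]
  refine Tendsto.mul ?_ (tendsto_charFun_of_tendsto_eLpNorm
    (fun n => (s n).aemeasurable_integral hW.aemeasurable)
    hG.memLp.aestronglyMeasurable.aemeasurable hs t)
  have hclt := tendsto_charFun_inv_sqrt_mul_pow (P := gaussianReal 0 1) (X := hermiteTwo)
    (by fun_prop) integral_hermiteTwo (by simpa using! integral_hermiteTwo_sq) (t * σ)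
  refine (hclt.congr fun n => rfl).trans_eq ?_
  congr 2
  push_cast; ring

end Limits

theorem mainTheorem1 {Ω : Type u} [MeasurableSpace Ω] (P : Measure Ω)
    [IsProbabilityMeasure P] (W : ℝ≥0 → Ω → ℝ) (hW : IsBrownianReal W P)
    {Ω₁ : Type v} [MeasurableSpace Ω₁] (P₁ : Measure Ω₁) [IsProbabilityMeasure P₁]
    (Finf : Ω₁ → ℝ) :
    -- `Finf` is a limit in law of double Wiener–Itô integrals with respect to `W` ...
    (∃ F : ℕ → Ω → ℝ, (∀ n, ∃ f, IsDoubleWienerIntegral W P f (F n)) ∧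
      TendstoInDistribution F atTop Finf (fun _ => P) P₁) ↔
    -- ... iff it has the law of `N + I_2^W(f)`, with `N` centred Gaussian of variance `lam₀²`, independent of `W`, living
    -- on an extension `π : (Ω', P') → (Ω, P)` of the space that carries `W`.
    ∃ (lam₀ : ℝ) (f : ℝ≥0 × ℝ≥0 → ℝ) (G : Ω → ℝ), IsDoubleWienerIntegral W P f G ∧
      ∃ (Ω' : Type u) (_ : MeasurableSpace Ω') (P' : Measure Ω') (π : Ω' → Ω) (N : Ω' → ℝ),
        MeasurePreserving π P' P ∧
        HasLaw N (gaussianReal 0 ⟨lam₀ ^ 2, sq_nonneg lam₀⟩) P' ∧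
        IndepFun N (fun ω' t => W t (π ω')) P' ∧
        IdentDistrib Finf (fun ω' => N ω' + G (π ω')) P₁ P' := by
  have hW' : IsPreBrownianReal W P := hW.toIsPreBrownianReal
  constructor
  · rintro ⟨F, hF, hlim⟩
    obtain ⟨σ, f, G, hG, hchar⟩ := exists_charFun_eq_of_tendstoInDistribution hW' hF hlim
    set γ : Measure ℝ := gaussianReal 0 ⟨σ ^ 2, sq_nonneg σ⟩
    have hγprob : IsProbabilityMeasure γ := instIsProbabilityMeasureGaussianReal _ _
    have hπ : MeasurePreserving (Prod.fst : Ω × ℝ → Ω) (P.prod γ) P := measurePreserving_fst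
    have hN : HasLaw (Prod.snd : Ω × ℝ → ℝ) γ (P.prod γ) := measurePreserving_snd.hasLaw
    -- No measurability is needed: the product measure of a rectangle is the product of the outer
    -- measures of its sides.
    have hind : IndepFun (Prod.snd : Ω × ℝ → ℝ) (fun ω' t => W t ω'.1) (P.prod γ) := by
      rw [indepFun_iff_measure_inter_preimage_eq_mul]
      intro A B _ _
      have h1 : (Prod.snd : Ω × ℝ → ℝ) ⁻¹' A ∩ (fun ω' t => W t ω'.1) ⁻¹' B =
          ((fun ω t => W t ω) ⁻¹' B) ×ˢ A := by
        ext; simp [and_comm]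
      have h2 : (Prod.snd : Ω × ℝ → ℝ) ⁻¹' A = Set.univ ×ˢ A := by ext; simp
      have h3 : (fun (ω' : Ω × ℝ) t => W t ω'.1) ⁻¹' B =
          ((fun ω t => W t ω) ⁻¹' B) ×ˢ Set.univ := by ext; simp
      rw [h1, h2, h3, Measure.prod_prod, Measure.prod_prod, Measure.prod_prod]
      simp [mul_comm]
    have hGm : AEMeasurable (fun ω' : Ω × ℝ => G ω'.1) (P.prod γ) :=
      hG.memLp.aestronglyMeasurable.aemeasurable.comp_quasiMeasurePreserving
        hπ.quasiMeasurePreserving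
    refine ⟨σ, f, G, hG, Ω × ℝ, inferInstance, P.prod γ, Prod.fst, Prod.snd, hπ, hN, hind,
      hlim.aemeasurable_limit, hN.aemeasurable.add hGm, ?_⟩
    have := Measure.isProbabilityMeasure_map (μ := P₁) hlim.aemeasurable_limit
    have := Measure.isProbabilityMeasure_map (hN.aemeasurable.add hGm)
    refine Measure.ext_of_charFun (funext fun t => ?_)
    rw [hchar, hG.charFun_add_gaussian hW'.aemeasurable hπ hN hind]
    rfl
  · rintro ⟨σ, f, G, hG, Ω', _, P', π, N, hπ, hN, hind, hident⟩
    refine hG.exists_tendstoInDistribution_of_charFun_eq hW' (σ := σ) hident.aemeasurable_fst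
      fun t => ?_
    rw [hident.map_eq, hG.charFun_add_gaussian hW'.aemeasurable hπ hN hind]
    rfl
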